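/- Let $R$ be a commutative ring, let $\mathrm{FI}$ be the category of finite sets and injective maps, and let an FI-module be a functor from $\mathrm{FI}$ to the category of $R$-modules. For $n \ge 0$ write $[n] = \{1,\dots,n\}$. An FI-module $V$ is finitely generated if there are finitely many elements $v_i \in V([n_i])$ that are not all contained in any proper sub-FI-module of $V$. The degree of an FI-module $V$ is $$\deg(V) = \sup\{\, n \in \mathbb{N} \mid V([n]) \neq 0 \,\},$$ with $\sup \emptyset = -\infty$. For an FI-module $V$ let $JV \subseteq V$ be the sub-FI-module such that, for each finite set $X$, $(JV)(X)$ is the $R$-submodule of $V(X)$ spanned by the images of the maps $V([m]) \to V(X)$ induced by all injections $[m] \to X$ with $m < |X|$. For $a \ge 0$ let the FI-homology functor $H^{\mathrm{FI}}_a$ be the $a$-th left derived functor of the right exact functor $V \mapsto V/JV$ from FI-modules to FI-modules. The Castelnuovo–Mumford regularity $\mathrm{reg}(V)$ is the infimum of the set of all $c \in \mathbb{Z}$ such that $$\deg\bigl(H^{\mathrm{FI}}_a(V)\bigr) \le c + a \quad \text{for every } a \ge 1,$$ with $\inf \emptyset = \infty$ (and infimum $-\infty$ if the set is not bounded below). **Theorem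 1.2.** Let $V$ be a finitely generated FI-module with $\deg(V) < \infty$. Then $$\mathrm{reg}(V) = \deg(V).$$ -/

import Mathlib

open CategoryTheory CategoryTheory.Limits

universe u

/-- An object of the category `FI`: a finite set. -/
structure FI : Type 1 where
  /-- The underlying set. -/
  carrier : Type
  [finite : Finite carrier]

namespace FI

attribute [instance] FI.finite

/-- The morphisms of `FI` are the injective maps. -/
instance : Category FI where
  Hom X Y := X.carrier ↪ Y.carrier
  id X := Function.Embedding.refl X.carrier
  comp f g := f.trans g

/-- The standard finite set `[n]` with `n` elements. -/
def std (n : ℕ) : FI := ⟨Fin n⟩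

end FI

/-- An `FI`-module over `R` is a functor from `FI` to `R`-modules. -/
abbrev FIMod (R : Type u) [CommRing R] : Type (u + 1) := FI ⥤ ModuleCat.{u} R

namespace FIMod

noncomputable section

variable {R : Type u} [CommRing R]

lemma map_comp_hom_apply (V : FIMod R) {X Y Z : FI} (f : X ⟶ Y) (g : Y ⟶ Z) (v : V.obj X) :
    (V.map (f ≫ g)).hom v = (V.map g).hom ((V.map f).hom v) := by
  rw [V.map_comp]; rfl

lemma naturality_hom_apply {V W : FIMod R} (φ : V ⟶ W) {X Y : FI} (f : X ⟶ Y) (v : V.obj X) :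
    (φ.app Y).hom ((V.map f).hom v) = (W.map f).hom ((φ.app X).hom v) := by
  have h := congrArg (fun k => k.hom v) (φ.naturality f)
  exact h

/-- `V` is finitely generated: there are finitely many elements `v i ∈ V([n i])` such that the
smallest sub-`FI`-module containing them (at `X`, the span of all their images under the maps
`[n i] → X`) is all of `V`. -/
def FinitelyGenerated (V : FIMod R) : Prop :=
  ∃ (k : ℕ) (n : Fin k → ℕ) (v : ∀ i, V.obj (FI.std (n i))), ∀ X : FI,
    Submodule.span R {x : V.obj X | ∃ (i : Fin k) (f : FI.std (n i) ⟶ X),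
      x = (V.map f).hom (v i)} = ⊤

/-- The degree `sup {n | V([n]) ≠ 0}`, the supremum of the empty set being `-∞`. -/
def degree (V : FIMod R) : EReal :=
  sSup {x : EReal | ∃ n : ℕ, Nontrivial (V.obj (FI.std n)) ∧ x = (n : EReal)}

/-! ### The functor `V ↦ V / JV` -/

/-- The submodule `(JV)(X)` of `V(X)`: the span of the images of all maps `V([m]) → V(X)`
induced by injections `[m] → X` with `m < |X|`. -/
def J (V : FIMod R) (X : FI) : Submodule R (V.obj X) :=
  Submodule.span R {x : V.obj X | ∃ (m : ℕ) (_ : m < Nat.card X.carrier)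
    (f : FI.std m ⟶ X) (v : V.obj (FI.std m)), x = (V.map f).hom v}

lemma J_le_comap_map (V : FIMod R) {X Y : FI} (g : X ⟶ Y) :
    V.J X ≤ (V.J Y).comap (V.map g).hom := by
  refine Submodule.span_le.2 ?_
  rintro _ ⟨m, hm, f, v, rfl⟩
  refine Submodule.subset_span ⟨m, ?_, f ≫ g, v, ?_⟩
  · exact lt_of_lt_of_le hm (Nat.card_le_card_of_injective _ (Function.Embedding.injective g))
  · exact (V.map_comp_hom_apply f g v).symm

lemma J_le_comap_app {V W : FIMod R} (φ : V ⟶ W) (X : FI) :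
    V.J X ≤ (W.J X).comap (φ.app X).hom := by
  refine Submodule.span_le.2 ?_
  rintro _ ⟨m, hm, f, v, rfl⟩
  exact Submodule.subset_span ⟨m, hm, f, (φ.app _).hom v, naturality_hom_apply φ f v⟩

/-- The quotient `FI`-module `V / JV`. -/
def quotJ (V : FIMod R) : FIMod R where
  obj X := ModuleCat.of R (V.obj X ⧸ V.J X)
  map {X Y} g := ModuleCat.ofHom ((V.J X).mapQ (V.J Y) (V.map g).hom (V.J_le_comap_map g))
  map_id X := by
    ext x
    exact congrArg (Submodule.Quotient.mk (p := V.J X)) (by rw [V.map_id]; rfl)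
  map_comp {X Y Z} f g := by
    ext x
    exact congrArg (Submodule.Quotient.mk (p := V.J Z)) (V.map_comp_hom_apply f g x)

/-- The functor `H₀^FI : V ↦ V / JV` from `FI`-modules to `FI`-modules. -/
def H0 (R : Type u) [CommRing R] : FIMod R ⥤ FIMod R where
  obj V := V.quotJ
  map {V W} φ :=
    { app := fun X => ModuleCat.ofHom
        ((V.J X).mapQ (W.J X) (φ.app X).hom (J_le_comap_app φ X))
      naturality := by
        intro X Y f
        ext x
        induction x using Submodule.Quotient.induction_on with | H x => ?_
        exact congrArg (Submodule.Quotient.mk (p := W.J Y)) (naturality_hom_apply φ f x) }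
  map_id V := by
    ext X x
    induction x using Submodule.Quotient.induction_on with | H x => ?_
    rfl
  map_comp φ ψ := by
    ext X x
    induction x using Submodule.Quotient.induction_on with | H x => ?_
    rfl

instance : (H0 R).Additive where
  map_add {V W φ ψ} := by
    ext X x
    induction x using Submodule.Quotient.induction_on with | H x => ?_
    rfl

/-! ### The category of `FI`-modules has enough projectives -/

/-- The `FI`-module `M(d)`, with `M(d)(X)` free on the set of injections `[d] → X`. -/
def M (R : Type u) [CommRing R] (d : ℕ) : FIMod R where
  obj X := ModuleCat.of R ((FI.std d ⟶ X) →₀ R)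
  map g := ModuleCat.ofHom (Finsupp.lmapDomain R R fun f => f ≫ g)
  map_id X := by
    refine ModuleCat.hom_ext (Finsupp.lhom_ext' fun f => LinearMap.ext_ring ?_)
    exact (Finsupp.mapDomain_single).trans (by rw [Category.comp_id]; rfl)
  map_comp g h := by
    refine ModuleCat.hom_ext (Finsupp.lhom_ext' fun f => LinearMap.ext_ring ?_)
    change Finsupp.mapDomain _ (Finsupp.single f 1) =
      Finsupp.mapDomain _ (Finsupp.mapDomain _ (Finsupp.single f (1 : R)))
    simp only [Finsupp.mapDomain_single, Category.assoc]

/-- The morphism `M(d) → V` that corresponds to `v ∈ V([d])`. -/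
def ofElement (V : FIMod R) (d : ℕ) (v : V.obj (FI.std d)) : M R d ⟶ V where
  app X := ModuleCat.ofHom
    (Finsupp.linearCombination R fun f : FI.std d ⟶ X => (V.map f).hom v)
  naturality X Y g := by
    refine ModuleCat.hom_ext (Finsupp.lhom_ext' fun f => LinearMap.ext_ring ?_)
    change Finsupp.linearCombination R (fun f : FI.std d ⟶ Y => (V.map f).hom v)
        (Finsupp.mapDomain _ (Finsupp.single f (1 : R))) =
      (V.map g).hom (Finsupp.linearCombination R (fun f : FI.std d ⟶ X => (V.map f).hom v)
        (Finsupp.single f 1))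
    simp only [Finsupp.mapDomain_single, Finsupp.linearCombination_single, one_smul]
    exact V.map_comp_hom_apply f g v

lemma ofElement_id (V : FIMod R) (d : ℕ) (v : V.obj (FI.std d)) :
    ((V.ofElement d v).app (FI.std d)).hom (Finsupp.single (𝟙 (FI.std d)) (1 : R)) = v := by
  change Finsupp.linearCombination R (fun f : FI.std d ⟶ FI.std d => (V.map f).hom v)
    (Finsupp.single (𝟙 _) 1) = v
  rw [Finsupp.linearCombination_single, one_smul, V.map_id]
  rfl

lemma M_hom_ext {V : FIMod R} {d : ℕ} {φ ψ : M R d ⟶ V}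
    (h : (φ.app (FI.std d)).hom (Finsupp.single (𝟙 (FI.std d)) (1 : R)) =
      (ψ.app (FI.std d)).hom (Finsupp.single (𝟙 (FI.std d)) (1 : R))) : φ = ψ := by
  ext X : 2
  refine ModuleCat.hom_ext (Finsupp.lhom_ext' fun f => LinearMap.ext_ring ?_)
  have key : (Finsupp.single f (1 : R) : (FI.std d ⟶ X) →₀ R) =
      ((M R d).map f).hom (Finsupp.single (𝟙 (FI.std d)) (1 : R)) := by
    exact ((Finsupp.mapDomain_single).trans (by rw [Category.id_comp])).symm
  change (φ.app X).hom (Finsupp.single f (1 : R)) = (ψ.app X).hom (Finsupp.single f (1 : R))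
  rw [key]
  erw [naturality_hom_apply φ f, naturality_hom_apply ψ f]
  exact congrArg _ h

instance (d : ℕ) : Projective (M R d) where
  factors {V W} φ e he := by
    have hs : Function.Surjective (e.app (FI.std d)).hom :=
      (ModuleCat.epi_iff_surjective _).1 inferInstance
    obtain ⟨v, hv⟩ := hs ((φ.app (FI.std d)).hom (Finsupp.single (𝟙 (FI.std d)) (1 : R)))
    refine ⟨V.ofElement d v, M_hom_ext ?_⟩
    exact (congrArg (e.app (FI.std d)).hom (ofElement_id V d v)).trans hv

instance : EnoughProjectives (FIMod R) where
  presentation V := by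
    let g : (Σ d : ℕ, V.obj (FI.std d)) → FIMod R := fun s => M R s.1
    have hg : ∀ s, Projective (g s) := fun s => inferInstanceAs (Projective (M R s.1))
    let π : (∐ g) ⟶ V := Sigma.desc fun s => V.ofElement s.1 s.2
    have hp : Projective (∐ g) :=
      ⟨fun φ e _ => ⟨Sigma.desc fun b => Projective.factorThru (Sigma.ι g b ≫ φ) e,
        Sigma.hom_ext _ _ fun b => by
          rw [← Category.assoc, Sigma.ι_desc, Projective.factorThru_comp]⟩⟩
    suffices hπ : Epi π from ⟨{ p := ∐ g, projective := hp, f := π, epi := hπ }⟩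
    refine Preadditive.epi_of_cancel_zero _ fun {W} ψ hψ => ?_
    have h0 : ∀ (d : ℕ) (v : V.obj (FI.std d)), (ψ.app (FI.std d)).hom v = 0 := by
      intro d v
      have h1 : V.ofElement d v ≫ ψ = 0 := by
        have h2 : Sigma.ι g ⟨d, v⟩ ≫ π ≫ ψ = 0 := by rw [hψ, comp_zero]
        rw [← Category.assoc, Sigma.ι_desc] at h2
        exact h2
      have h3 := congrArg (fun k : M R d ⟶ W =>
        (k.app (FI.std d)).hom (Finsupp.single (𝟙 (FI.std d)) (1 : R))) h1
      exact (congrArg (ψ.app (FI.std d)).hom (ofElement_id V d v)).symm.trans h3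
    ext X x
    let e : X.carrier ≃ Fin (Nat.card X.carrier) := Finite.equivFin X.carrier
    let f : X ⟶ FI.std (Nat.card X.carrier) := e.toEmbedding
    let f' : FI.std (Nat.card X.carrier) ⟶ X := e.symm.toEmbedding
    have hf : f ≫ f' = 𝟙 X := Function.Embedding.ext fun y => e.symm_apply_apply y
    have hx : x = (V.map f').hom ((V.map f).hom x) := by
      rw [← map_comp_hom_apply, hf, V.map_id]; rfl
    change (ψ.app X).hom x = 0
    rw [hx, naturality_hom_apply, h0, map_zero]

/-! ### `FI`-homology and regularity -/

/-- The `FI`-homology functor `H_a^FI`, the `a`-th left derived functor of `V ↦ V / JV`. -/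
def homology (R : Type u) [CommRing R] (a : ℕ) : FIMod R ⥤ FIMod R :=
  (H0 R).leftDerived a

/-- The Castelnuovo–Mumford regularity: the infimum of all integers `c` with
`deg (H_a^FI(V)) ≤ c + a` for all `a ≥ 1`, the infimum of the empty set being `∞`. -/
def regularity (V : FIMod R) : EReal :=
  sInf {x : EReal | ∃ c : ℤ, x = ((c : ℝ) : EReal) ∧
    ∀ a : ℕ, 1 ≤ a → ((homology R a).obj V).degree ≤ (((c + a : ℤ) : ℝ) : EReal)}

end

end FIMod

/-! Write `Tor_a(V)_n` for the value of `H_a^FI(V)` on an `n`-element set, and `ΣV` for the shift `X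
↦ V(X ⊔ {∗})`. On a projective `P` the map `P → ΣP` splits, `ΣP` is projective, and `0 → (P/JP)(X) →
(ΣP/JΣP)(X) → (P/JP)(X ⊔ {∗}) → 0` is exact. A projective resolution of `V` thus gives a long exact
sequence containing `Tor_{a+1}(ΣV)_n → Tor_{a+1}(V)_{n+1} → Tor_a(V)_n`. Since higher `Tor` vanishes
on the empty set, induction on `n` yields `length Tor_a(V)_n ≤ C(n,a) · length V_{n-a}`
(`length_tor_le`). Hence `deg H_a(V) ≤ deg V + a`, which is the upper bound. If all maps induced by
non-bijective injections are zero, then `V → ΣV` is zero, the sequence breaks up, and equality holds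
(`length_tor_eq`).

For the lower bound let `d = deg V`. Nakayama gives a maximal ideal `I` with `IV_d ≠ V_d`. Let `W`
be the part of `V/IV` in degrees at least `d` and `Q` the quotient of `V/IV` by `W`. Suppose
`Tor_a(V)_{d+a} = 0`. As `Tor_{a-1}(IV)_{d+a} = 0` by the length bound, `Tor_a(V/IV)_{d+a} = 0`, so
`Tor_{a+1}(Q)_{d+a}` surjects onto `Tor_a(W)_{d+a}`. Comparing lengths, `C(d+a,a) ≤ C(d+a,a+1) · L`
with `L = length Q_{d-1}` finite, that is, `a + 1 ≤ dL`. This fails for large `a`, so some `H_a(V)`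
reaches degree `d + a` (`exists_nontrivial_tor`). Only two surjections between derived functors are
needed here; they come from dimension shifting, which settles them for odd `a ≥ 3`. -/

section LeftDerivedDimensionShift

variable {C : Type*} [Category* C] [Abelian C]

/-! ### Left derived functors by dimension shifting along syzygies. -/

namespace CategoryTheory.ProjectiveResolution

/-- The augmentation `P₀ ⟶ Z` of a projective resolution of `Z`. -/
noncomputable def augmentation {Z : C} (Q : ProjectiveResolution Z) : Q.complex.X 0 ⟶ Z :=
  Q.π.f 0

lemma d_comp_augmentation {Z : C} (Q : ProjectiveResolution Z) :
    Q.complex.d 1 0 ≫ Q.augmentation = 0 :=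
  Q.complex_d_comp_π_f_zero

instance {Z : C} (Q : ProjectiveResolution Z) : Epi Q.augmentation :=
  inferInstanceAs (Epi (Q.π.f 0))

lemma exact_augmentation {Z : C} (Q : ProjectiveResolution Z) :
    (ShortComplex.mk _ _ Q.d_comp_augmentation).Exact :=
  ShortComplex.exact_of_g_is_cokernel _ Q.isColimitCokernelCofork

lemma d_comp_augmentation_comp {Z X : C} (Q : ProjectiveResolution Z) (f : Z ⟶ X) :
    Q.complex.d 1 0 ≫ Q.augmentation ≫ f = 0 := by
  rw [← Category.assoc, d_comp_augmentation, zero_comp]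

lemma exact_augmentation_comp {Z X : C} (Q : ProjectiveResolution Z) (f : Z ⟶ X) [Mono f] :
    (ShortComplex.mk _ _ (Q.d_comp_augmentation_comp f)).Exact := by
  let α : ShortComplex.mk _ _ Q.d_comp_augmentation ⟶
      ShortComplex.mk _ _ (Q.d_comp_augmentation_comp f) :=
    { τ₁ := 𝟙 _, τ₂ := 𝟙 _, τ₃ := f }
  have : Epi α.τ₁ := inferInstanceAs (Epi (𝟙 _))
  have : IsIso α.τ₂ := inferInstanceAs (IsIso (𝟙 _))
  have : Mono α.τ₃ := inferInstanceAs (Mono f)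
  exact (ShortComplex.exact_iff_of_epi_of_isIso_of_mono α).1 Q.exact_augmentation

lemma augmentation_comp_comp {S : ShortComplex C} (Q : ProjectiveResolution S.X₁) :
    (Q.augmentation ≫ S.f) ≫ S.g = 0 := by
  rw [Category.assoc, S.zero, comp_zero]

lemma exact_splice {S : ShortComplex C} (hS : S.ShortExact) (Q : ProjectiveResolution S.X₁) :
    (ShortComplex.mk _ _ Q.augmentation_comp_comp).Exact := by
  let α : ShortComplex.mk _ _ Q.augmentation_comp_comp ⟶ S :=
    { τ₁ := Q.augmentation, τ₂ := 𝟙 _, τ₃ := 𝟙 _ }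
  have : Epi α.τ₁ := inferInstanceAs (Epi Q.augmentation)
  have : IsIso α.τ₂ := inferInstanceAs (IsIso (𝟙 _))
  have : Mono α.τ₃ := inferInstanceAs (Mono (𝟙 _))
  exact (ShortComplex.exact_iff_of_epi_of_isIso_of_mono α).2 hS.exact

/-- The augmentation of the complex obtained from a projective resolution of the kernel. -/
noncomputable def spliceπ {S : ShortComplex C} (Q : ProjectiveResolution S.X₁) :
    Q.complex.augment (Q.augmentation ≫ S.f) (Q.d_comp_augmentation_comp S.f) ⟶
      (ChainComplex.single₀ C).obj S.X₃ :=
  (ChainComplex.toSingle₀Equiv _ _).symm ⟨S.g, Q.augmentation_comp_comp⟩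

lemma spliceπ_f_zero {S : ShortComplex C} (Q : ProjectiveResolution S.X₁) :
    Q.spliceπ.f 0 = S.g :=
  ChainComplex.toSingle₀Equiv_symm_apply_f_zero _ _

/-- A projective resolution of the kernel of an epimorphism from a projective object, continued
to a projective resolution of the target. -/
noncomputable def splice {S : ShortComplex C} (hS : S.ShortExact) (hP : Projective S.X₂)
    (Q : ProjectiveResolution S.X₁) : ProjectiveResolution S.X₃ where
  complex := Q.complex.augment (Q.augmentation ≫ S.f) (Q.d_comp_augmentation_comp S.f)
  projective n := by
    cases n with
    | zero => exact hP
    | succ n => exact Q.projective n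
  π := Q.spliceπ
  quasiIso := ⟨fun n => by
    have := hS.mono_f
    cases n with
    | zero =>
      rw [ChainComplex.quasiIsoAt₀_iff, ShortComplex.quasiIso_iff_of_zeros']
      · refine (ShortComplex.exact_and_epi_g_iff_of_iso ?_).2 ⟨Q.exact_splice hS, hS.epi_g⟩
        exact ShortComplex.isoMk (Iso.refl _) (Iso.refl _) (Iso.refl _)
          ((Category.id_comp _).trans (Category.comp_id _).symm)
          ((Category.id_comp S.g).trans ((Q.spliceπ_f_zero).symm.trans
            (Category.comp_id (Q.spliceπ.f 0)).symm))
      all_goals rfl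
    | succ n =>
      rw [quasiIsoAt_iff_exactAt']
      · rw [HomologicalComplex.exactAt_iff' _ (n + 1 + 1) (n + 1) n (by simp) (by simp)]
        -- In degree 1 exactness survives because composing the augmentation with the monomorphism
        -- `S.f` does not change its kernel; above that the complex is the given resolution, moved
        -- up by one.
        cases n with
        | zero => exact Q.exact_augmentation_comp S.f
        | succ n => exact Q.exact_succ n
      · apply ChainComplex.exactAt_succ_single_obj⟩

end CategoryTheory.ProjectiveResolution

/-- If `g` factors as a cokernel of `f` followed by `m`, the homology of `(f, g)` is the kernel
of `m`. -/
noncomputable def CategoryTheory.ShortComplex.homologyIsoKernelOfFac (K : ShortComplex C) {Q : C}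
    {p : K.X₂ ⟶ Q} {wp : K.f ≫ p = 0} (hp : IsColimit (CokernelCofork.ofπ p wp)) (m : Q ⟶ K.X₃)
    (hm : p ≫ m = K.g) : K.homology ≅ kernel m :=
  have hd : hp.desc (CokernelCofork.ofπ K.g K.zero) = m :=
    Cofork.IsColimit.hom_ext hp ((Cofork.IsColimit.π_desc hp).trans hm.symm)
  ShortComplex.RightHomologyData.homologyIso
    { Q := Q
      H := kernel m
      p := p
      ι := kernel.ι _
      wp := wp
      hp := hp
      wι := by rw [hd, kernel.condition]
      hι := KernelFork.IsLimit.ofι' _ _ fun k hk =>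
        ⟨kernel.lift _ k (by rwa [hd] at hk), kernel.lift_ι _ _ _⟩ }

variable {D : Type*} [Category* D] [Abelian D] [EnoughProjectives C]

/-- One cover `P` of the middle term also covers `S.X₃`, and the two kernels differ by `S.X₁`. With
`Z = ΩX₂` and `Z' = ΩX₃`, this rotates `X₁ → X₂ → X₃` to `ΩX₂ → ΩX₃ → X₁`. -/
lemma exists_projective_rotation {S : ShortComplex C} (hS : S.ShortExact) :
    ∃ (P Z Z' : C) (i : Z ⟶ Z') (j : Z' ⟶ P) (p : P ⟶ S.X₂) (q : Z' ⟶ S.X₁)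
      (h₂ : (i ≫ j) ≫ p = 0) (h₃ : j ≫ p ≫ S.g = 0) (h₁ : i ≫ q = 0), Projective P ∧
      (ShortComplex.mk (i ≫ j) p h₂).ShortExact ∧
      (ShortComplex.mk j (p ≫ S.g) h₃).ShortExact ∧
      (ShortComplex.mk i q h₁).ShortExact ∧ j ≫ p = q ≫ S.f := by
  have := hS.mono_f
  have := hS.epi_g
  let p := Projective.π S.X₂
  let i : kernel p ⟶ kernel (p ≫ S.g) := kernel.lift _ (kernel.ι p) (by simp)
  have hi : i ≫ kernel.ι (p ≫ S.g) = kernel.ι p := kernel.lift_ι _ _ _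
  let q : kernel (p ≫ S.g) ⟶ S.X₁ := hS.exact.lift (kernel.ι (p ≫ S.g) ≫ p) (by simp)
  have hq : q ≫ S.f = kernel.ι (p ≫ S.g) ≫ p := hS.exact.lift_f _ _
  have : Mono i := mono_of_mono_fac hi
  have h₁ : i ≫ q = 0 := by
    rw [← cancel_mono S.f, Category.assoc, hq, ← Category.assoc, hi, kernel.condition, zero_comp]
  have e₁ : (ShortComplex.mk i q h₁).Exact := by
    rw [ShortComplex.exact_iff_exact_up_to_refinements]
    intro A x hx
    refine ⟨A, 𝟙 A, inferInstance, kernel.lift p (x ≫ kernel.ι _) ?_, ?_⟩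
    · have : x ≫ q = 0 := hx
      rw [Category.assoc, ← hq, reassoc_of% this, zero_comp]
    · rw [← cancel_mono (kernel.ι (p ≫ S.g)), Category.assoc, Category.assoc, Category.id_comp]
      erw [hi]
      simp
  have e₂ : Epi q := by
    rw [epi_iff_surjective_up_to_refinements]
    intro A y
    obtain ⟨A', π, hπ, x, hx⟩ := surjective_up_to_refinements_of_epi p (y ≫ S.f)
    refine ⟨A', π, hπ, kernel.lift _ x ?_, ?_⟩
    · rw [← reassoc_of% hx]; simp
    · rw [← cancel_mono S.f, Category.assoc, Category.assoc, hq, kernel.lift_ι_assoc]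
      exact hx
  refine ⟨Projective.over S.X₂, kernel p, kernel (p ≫ S.g), i, kernel.ι _, p, q, by simp [hi],
    by simp, h₁, inferInstance, ?_, ?_, ⟨e₁⟩, hq.symm⟩
  · have h := ShortComplex.exact_kernel p
    simp only [hi]
    exact { exact := h, mono_f := inferInstance, epi_g := inferInstance }
  · exact { exact := ShortComplex.exact_kernel (p ≫ S.g), mono_f := inferInstance
            epi_g := inferInstanceAs (Epi (p ≫ S.g)) }

section

variable (F : C ⥤ D) [F.Additive]

lemma nonempty_leftDerived_iso_of_shortExact {S : ShortComplex C} (hS : S.ShortExact)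
    (hP : Projective S.X₂) (n : ℕ) :
    Nonempty ((F.leftDerived (n + 2)).obj S.X₃ ≅ (F.leftDerived (n + 1)).obj S.X₁) := by
  let Q := projectiveResolution S.X₁
  let K := (F.mapHomologicalComplex (ComplexShape.down ℕ)).obj (Q.splice hS hP).complex
  let K' := (F.mapHomologicalComplex (ComplexShape.down ℕ)).obj Q.complex
  have e₁ : K.homology (n + 2) ≅ (K.sc' (n + 3) (n + 2) (n + 1)).homology :=
    ShortComplex.homologyMapIso (K.isoSc' _ _ _ (by simp) (by simp))
  have e₂ : K'.homology (n + 1) ≅ (K'.sc' (n + 2) (n + 1) n).homology :=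
    ShortComplex.homologyMapIso (K'.isoSc' _ _ _ (by simp) (by simp))
  -- The spliced resolution is that of `S.X₁` with degrees raised by one, so away from degree 0 the
  -- differentials coincide definitionally.
  have e₃ : K.sc' (n + 3) (n + 2) (n + 1) = K'.sc' (n + 2) (n + 1) n := rfl
  exact ⟨(Q.splice hS hP).isoLeftDerivedObj F (n + 2) ≪≫ e₁ ≪≫ eqToIso (by rw [e₃]) ≪≫ e₂.symm ≪≫
    (Q.isoLeftDerivedObj F (n + 1)).symm⟩

variable [PreservesFiniteColimits F]

/-- By right exactness `F.map Q.augmentation` is the cokernel of the image of the differential, so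
the homology in degree 1 is what `F.map S.f` kills. -/
lemma nonempty_leftDerived_one_iso_of_shortExact {S : ShortComplex C} (hS : S.ShortExact)
    (hP : Projective S.X₂) :
    Nonempty ((F.leftDerived 1).obj S.X₃ ≅ kernel (F.map S.f)) := by
  let Q := projectiveResolution S.X₁
  let K := (F.mapHomologicalComplex (ComplexShape.down ℕ)).obj (Q.splice hS hP).complex
  have e₁ : K.homology 1 ≅ (K.sc' 2 1 0).homology :=
    ShortComplex.homologyMapIso (K.isoSc' _ _ _ (by simp) (by simp))
  have hg : (K.sc' 2 1 0).g = F.map Q.augmentation ≫ F.map S.f := F.map_comp _ _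
  have hw : (K.sc' 2 1 0).f ≫ F.map Q.augmentation = 0 := by
    change F.map (Q.complex.d 1 0) ≫ F.map Q.augmentation = 0
    rw [← F.map_comp, Q.d_comp_augmentation, F.map_zero]
  let hp : IsColimit (CokernelCofork.ofπ (F.map Q.augmentation) hw) :=
    CokernelCofork.mapIsColimit _ Q.exact_augmentation.gIsCokernel F
  exact ⟨(Q.splice hS hP).isoLeftDerivedObj F 1 ≪≫ e₁ ≪≫
    (K.sc' 2 1 0).homologyIsoKernelOfFac hp _ hg.symm⟩

/-- The first derived functor is the kernel of `F` applied to a monomorphism; dimension shifting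
does the rest. -/
lemma isZero_leftDerived_succ_of_preservesMonomorphisms [F.PreservesMonomorphisms] (n : ℕ) (V : C) :
    IsZero ((F.leftDerived (n + 1)).obj V) := by
  induction n generalizing V with
  | zero =>
    have hS : (ShortComplex.mk (kernel.ι (Projective.π V)) (Projective.π V) (by simp)).ShortExact :=
      { exact := ShortComplex.exact_kernel _, mono_f := inferInstance, epi_g := inferInstance }
    obtain ⟨e⟩ := nonempty_leftDerived_one_iso_of_shortExact F hS inferInstance
    exact (isZero_kernel_of_mono (F.map (kernel.ι (Projective.π V)))).of_iso e
  | succ n ih =>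
    have hS : (ShortComplex.mk (kernel.ι (Projective.π V)) (Projective.π V) (by simp)).ShortExact :=
      { exact := ShortComplex.exact_kernel _, mono_f := inferInstance, epi_g := inferInstance }
    obtain ⟨e⟩ := nonempty_leftDerived_iso_of_shortExact F hS inferInstance n
    exact (ih _).of_iso e

/-- For a projective rotation the two derived objects are the kernels of `F(ΩX₂) → F(P)` and `F(ΩX₃)
→ F(P)`. An element of the second dies in `F(X₂)`, hence in `F(X₁)` since `F.map S.f` is mono, hence
lifts to `F(ΩX₂)` by right exactness. -/
lemma exists_epi_leftDerived_one {S : ShortComplex C} (hS : S.ShortExact) (hF : Mono (F.map S.f)) :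
    ∃ e : (F.leftDerived 1).obj S.X₂ ⟶ (F.leftDerived 1).obj S.X₃, Epi e := by
  obtain ⟨P, Z, Z', i, j, p, q, h₂, h₃, h₁, hP, s₂, s₃, s₁, hjq⟩ := exists_projective_rotation hS
  obtain ⟨e₂⟩ := nonempty_leftDerived_one_iso_of_shortExact F s₂ hP
  obtain ⟨e₃⟩ := nonempty_leftDerived_one_iso_of_shortExact F s₃ hP
  let m : kernel (F.map (i ≫ j)) ⟶ kernel (F.map j) :=
    kernel.map _ _ (F.map i) (𝟙 _) (by simp)
  suffices Epi m from ⟨e₂.hom ≫ m ≫ e₃.inv, inferInstance⟩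
  rw [epi_iff_surjective_up_to_refinements]
  intro A y
  have hy : (y ≫ kernel.ι (F.map j)) ≫ F.map q = 0 := by
    rw [← cancel_mono (F.map S.f), Category.assoc, ← F.map_comp, ← hjq, F.map_comp]
    simp
  have hex : ((ShortComplex.mk i q h₁).map F).Exact :=
    s₁.exact.map_of_epi_of_preservesCokernel F s₁.epi_g inferInstance
  obtain ⟨A', π, hπ, (x : A' ⟶ F.obj Z),
    (hx : π ≫ y ≫ kernel.ι (F.map j) = x ≫ F.map i)⟩ := hex.exact_up_to_refinements _ hy
  refine ⟨A', π, hπ, kernel.lift _ x ?_, ?_⟩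
  · rw [F.map_comp, ← Category.assoc, ← hx, Category.assoc, Category.assoc, kernel.condition,
      comp_zero, comp_zero]
  · rw [← cancel_mono (kernel.ι (F.map j))]
    simpa [m] using hx

lemma IsZero.mono_of_iso_kernel {X Y Z : D} {f : X ⟶ Y} (h : IsZero Z) (e : Z ≅ kernel f) :
    Mono f :=
  Preadditive.mono_of_kernel_zero ((h.of_iso e.symm).eq_of_src _ _)

/-- Three rotations turn `S` into `Ω²X₁ → Ω²X₂ → Ω²X₃` and lower derived degrees by two. Odd degrees
therefore descend to degree 1. -/
lemma exists_epi_leftDerived_odd (k : ℕ) {S : ShortComplex C} (hS : S.ShortExact)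
    (h : IsZero ((F.leftDerived (2 * k + 2)).obj S.X₁)) :
    ∃ e : (F.leftDerived (2 * k + 3)).obj S.X₂ ⟶ (F.leftDerived (2 * k + 3)).obj S.X₃, Epi e := by
  induction k generalizing S with
  | zero =>
    obtain ⟨P, Z, Z', i, j, p, q, h₂, h₃, h₁, hP, s₂, s₃, s₁, -⟩ := exists_projective_rotation hS
    obtain ⟨e₂⟩ := nonempty_leftDerived_iso_of_shortExact F s₂ hP 1
    obtain ⟨e₃⟩ := nonempty_leftDerived_iso_of_shortExact F s₃ hP 1
    obtain ⟨P', Y, Y', i', j', p', q', h₂', h₃', h₁', hP', s₂', s₃', s₁', -⟩ :=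
      exists_projective_rotation s₁
    obtain ⟨e₂'⟩ := nonempty_leftDerived_iso_of_shortExact F s₂' hP' 0
    obtain ⟨e₃'⟩ := nonempty_leftDerived_iso_of_shortExact F s₃' hP' 0
    obtain ⟨P'', X, X', i'', j'', p'', q'', h₂'', h₃'', h₁'', hP'', s₂'', s₃'', s₁'', -⟩ :=
      exists_projective_rotation s₁'
    obtain ⟨e₂''⟩ := nonempty_leftDerived_one_iso_of_shortExact F s₂'' hP''
    obtain ⟨e₃''⟩ := nonempty_leftDerived_iso_of_shortExact F s₃'' hP'' 0
    -- The second derived functor of `S.X₁` is the kernel of this map, and its vanishing makes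
    -- `F(Ω²X₁) → F(Ω²X₂)` mono.
    have hm : Mono (F.map (i'' ≫ j'')) := IsZero.mono_of_iso_kernel (h.of_iso e₃'.symm) e₂''
    rw [F.map_comp] at hm
    obtain ⟨e, he⟩ := exists_epi_leftDerived_one F s₁'' (mono_of_mono _ (F.map j''))
    exact ⟨e₂.hom ≫ e₃''.hom ≫ e ≫ e₂'.inv ≫ e₃.inv, inferInstance⟩
  | succ k ih =>
    obtain ⟨P, Z, Z', i, j, p, q, h₂, h₃, h₁, hP, s₂, s₃, s₁, -⟩ := exists_projective_rotation hS
    obtain ⟨e₂⟩ := nonempty_leftDerived_iso_of_shortExact F s₂ hP (2 * k + 3)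
    obtain ⟨e₃⟩ := nonempty_leftDerived_iso_of_shortExact F s₃ hP (2 * k + 3)
    obtain ⟨P', Y, Y', i', j', p', q', h₂', h₃', h₁', hP', s₂', s₃', s₁', -⟩ :=
      exists_projective_rotation s₁
    obtain ⟨e₂'⟩ := nonempty_leftDerived_iso_of_shortExact F s₂' hP' (2 * k + 2)
    obtain ⟨e₃'⟩ := nonempty_leftDerived_iso_of_shortExact F s₃' hP' (2 * k + 2)
    obtain ⟨P'', X, X', i'', j'', p'', q'', h₂'', h₃'', h₁'', hP'', s₂'', s₃'', s₁'', -⟩ :=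
      exists_projective_rotation s₁'
    obtain ⟨e₂''⟩ := nonempty_leftDerived_iso_of_shortExact F s₂'' hP'' (2 * k + 1)
    obtain ⟨e₃''⟩ := nonempty_leftDerived_iso_of_shortExact F s₃'' hP'' (2 * k + 2)
    obtain ⟨e, he⟩ := ih s₁'' ((h.of_iso e₃'.symm).of_iso e₂''.symm)
    exact ⟨e₂.hom ≫ e₃''.hom ≫ e ≫ e₂'.inv ≫ e₃.inv, inferInstance⟩

/-- This is the connecting map: the odd case applied to the rotated sequence `ΩX₂ → ΩX₃ → X₁`. -/
lemma exists_epi_leftDerived_even (k : ℕ) {S : ShortComplex C} (hS : S.ShortExact)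
    (h : IsZero ((F.leftDerived (2 * k + 3)).obj S.X₂)) :
    ∃ e : (F.leftDerived (2 * k + 4)).obj S.X₃ ⟶ (F.leftDerived (2 * k + 3)).obj S.X₁, Epi e := by
  obtain ⟨P, Z, Z', i, j, p, q, h₂, h₃, h₁, hP, s₂, s₃, s₁, -⟩ := exists_projective_rotation hS
  obtain ⟨e₂⟩ := nonempty_leftDerived_iso_of_shortExact F s₂ hP (2 * k + 1)
  obtain ⟨e₃⟩ := nonempty_leftDerived_iso_of_shortExact F s₃ hP (2 * k + 2)
  obtain ⟨e, he⟩ := exists_epi_leftDerived_odd F k s₁ (h.of_iso e₂.symm)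
  exact ⟨e₃.hom ≫ e, inferInstance⟩

end

end LeftDerivedDimensionShift

/-! ### Adjoining a point to a finite set, and injections into the enlarged set. -/

namespace FI

/-- The functor adjoining one point to a finite set. -/
def succ : FI ⥤ FI where
  obj X := ⟨Option X.carrier⟩
  map f := Function.Embedding.optionMap f
  map_id X := Function.Embedding.ext fun o => by cases o <;> rfl
  map_comp f g := Function.Embedding.ext fun o => by cases o <;> rfl

/-- The inclusion of a finite set into the set with one more point. -/
def toSucc : 𝟭 FI ⟶ succ where
  app _ := Function.Embedding.some
  naturality _ _ _ := rfl

/-- The complement of a point of `Option Y` in `Y`. -/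
def compl (Y : FI) (o : Option Y.carrier) : FI := ⟨{z : Y.carrier // some z ≠ o}⟩

open Classical in
/-- The map `Y → (Y \ o) ∪ {none}` sending `o`, if it is a point of `Y`, to `none`. -/
noncomputable def complFun (Y : FI) (o : Option Y.carrier) (z : Y.carrier) :
    Option (compl Y o).carrier :=
  if h : some z ≠ o then some ⟨z, h⟩ else none

lemma complFun_of_ne {Y : FI} {o : Option Y.carrier} {z : Y.carrier} (h : some z ≠ o) :
    complFun Y o z = some ⟨z, h⟩ := dif_pos h

lemma complFun_eq_none {Y : FI} {o : Option Y.carrier} {z : Y.carrier} (h : some z = o) :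
    complFun Y o z = none := dif_neg (not_not.2 h)

lemma complFun_injective (Y : FI) (o : Option Y.carrier) : Function.Injective (complFun Y o) := by
  intro z z' h
  by_cases h₁ : some z = o <;> by_cases h₂ : some z' = o
  · exact Option.some_injective _ (h₁.trans h₂.symm)
  · rw [complFun_eq_none h₁, complFun_of_ne h₂] at h
    exact absurd h.symm (Option.some_ne_none _)
  · rw [complFun_of_ne h₁, complFun_eq_none h₂] at h
    exact absurd h (Option.some_ne_none _)
  · rw [complFun_of_ne h₁, complFun_of_ne h₂] at h
    exact congrArg Subtype.val (Option.some_injective _ h)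

/-- The injection `Y → (Y \ o) ∪ {none}` sending `o`, if it is a point of `Y`, to `none`. -/
noncomputable def complHom (Y : FI) (o : Option Y.carrier) : Y ⟶ succ.obj (compl Y o) :=
  ⟨complFun Y o, complFun_injective Y o⟩

lemma complHom_comp_of_ne {Y X : FI} {o : Option Y.carrier} (f : compl Y o ⟶ X) {z : Y.carrier}
    (h : some z ≠ o) : (complHom Y o ≫ succ.map f).toFun z = some (f.toFun ⟨z, h⟩) :=
  (congrArg (Option.map f.toFun) (complFun_of_ne h)).trans rfl

lemma complHom_comp_of_eq {Y X : FI} {o : Option Y.carrier} (f : compl Y o ⟶ X) {z : Y.carrier}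
    (h : some z = o) : (complHom Y o ≫ succ.map f).toFun z = none :=
  (congrArg (Option.map f.toFun) (complFun_eq_none h)).trans rfl

lemma complHom_comp_eq_none_iff {Y X : FI} {o : Option Y.carrier} (f : compl Y o ⟶ X)
    (z : Y.carrier) : (complHom Y o ≫ succ.map f).toFun z = none ↔ some z = o := by
  refine ⟨fun h => ?_, complHom_comp_of_eq f⟩
  by_contra h'
  rw [complHom_comp_of_ne f h'] at h
  exact Option.some_ne_none _ h

/-- Every injection into `Option X` factors uniquely through some `complHom`. -/
lemma bijective_complHom_comp (Y X : FI) :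
    Function.Bijective fun p : Σ o : Option Y.carrier, (compl Y o ⟶ X) =>
      complHom Y p.1 ≫ succ.map p.2 := by
  constructor
  · rintro ⟨o, f⟩ ⟨o', f'⟩ (h : complHom Y o ≫ succ.map f = complHom Y o' ≫ succ.map f')
    have ho : o = o' := by
      ext z
      rw [eq_comm, ← complHom_comp_eq_none_iff f z, h, complHom_comp_eq_none_iff, eq_comm]
    subst ho
    refine congrArg (Sigma.mk o) (Function.Embedding.ext fun z => ?_)
    have := congrArg (fun k : Y ⟶ succ.obj X => k.toFun z.1) h
    rw [complHom_comp_of_ne f z.2, complHom_comp_of_ne f' z.2] at this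
    exact Option.some_injective _ this
  · intro F
    -- `o` records the preimage of the new point, and is `none` when there is no preimage.
    have ho : ∃ o : Option Y.carrier, ∀ z, F.toFun z = none ↔ some z = o := by
      by_cases h : ∃ y, F.toFun y = none
      · obtain ⟨y, hy⟩ := h
        refine ⟨some y, fun z => ⟨fun hz => congrArg some (F.inj' (hz.trans hy.symm)), fun hz => ?_⟩⟩
        rw [Option.some_injective _ hz, hy]
      · push Not at h
        exact ⟨none, fun z => ⟨fun hz => absurd hz (h z), fun hz => absurd hz (Option.some_ne_none z)⟩⟩
    obtain ⟨o, ho⟩ := ho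
    have hs : ∀ z : (compl Y o).carrier, ∃ x : X.carrier, F.toFun z.1 = some x := fun z =>
      Option.ne_none_iff_exists'.1 fun h => z.2 ((ho z.1).1 h)
    choose f hf using hs
    let f' : compl Y o ⟶ X := ⟨f, fun z z' h => Subtype.ext (F.inj' (by rw [hf, hf, h]))⟩
    refine ⟨⟨o, f'⟩, Function.Embedding.ext fun z => ?_⟩
    by_cases h : some z = o
    · exact (complHom_comp_of_eq f' h).trans ((ho z).2 h).symm
    · exact (complHom_comp_of_ne f' h).trans (hf ⟨z, h⟩).symm

lemma exists_comp_toSucc {Y X : FI} {F : Y ⟶ succ.obj X} (h : ∀ z, F.toFun z ≠ none) :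
    ∃ f : Y ⟶ X, f ≫ toSucc.app X = F := by
  choose f hf using fun z => Option.ne_none_iff_exists'.1 (h z)
  exact ⟨⟨f, fun z z' h => F.inj' (by rw [hf, hf, h])⟩,
    Function.Embedding.ext fun z => (hf z).symm⟩

lemma comp_toSucc_injective {Y X : FI} {f f' : Y ⟶ X}
    (h : f ≫ toSucc.app X = f' ≫ toSucc.app X) : f = f' :=
  Function.Embedding.ext fun z => Option.some_injective _ (congrArg (fun k : Y ⟶ succ.obj X => k.toFun z) h)

lemma exists_comp_toSucc_of_comp_map {Y X X' : FI} {F : Y ⟶ succ.obj X} {g : X ⟶ X'}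
    {f' : Y ⟶ X'} (h : f' ≫ toSucc.app X' = F ≫ succ.map g) :
    ∃ f : Y ⟶ X, f ≫ toSucc.app X = F := by
  refine exists_comp_toSucc fun z hz => ?_
  have : some (f'.toFun z) = Option.map g.toFun (F.toFun z) :=
    congrArg (fun k : Y ⟶ succ.obj X' => k.toFun z) h
  rw [hz] at this
  exact Option.some_ne_none _ this

end FI

/-! ### The shift functor and projective `FI`-modules. -/

namespace FIMod

noncomputable section

variable {R : Type u} [CommRing R]

/-- The shift functor `V ↦ V(- ⊔ {∗})`. -/
def shift (R : Type u) [CommRing R] : FIMod R ⥤ FIMod R :=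
  (Functor.whiskeringLeft FI FI (ModuleCat.{u} R)).obj FI.succ

instance : (shift R).Additive where
  map_add := rfl

/-- The natural map from an `FI`-module to its shift. -/
def toShift (R : Type u) [CommRing R] : 𝟭 (FIMod R) ⟶ shift R where
  app V := { app := fun X => V.map (FI.toSucc.app X)
             naturality := fun X Y f => by
              change V.map f ≫ V.map _ = V.map _ ≫ V.map (FI.succ.map f)
              rw [← V.map_comp, ← V.map_comp]
              exact congrArg V.map (FI.toSucc.naturality f) }
  naturality V W φ := by
    ext X : 2
    exact (φ.naturality _).symm

/-- A basis of an `FI`-module: elements `g i ∈ V(Y i)` whose images under the injections `Y i → X`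
form a basis of `V(X)`, for every `X`. -/
structure FreeBasis (V : FIMod R) where
  /-- The index set of the generators. -/
  ι : Type u
  /-- The sets in which the generators live. -/
  Y : ι → FI
  /-- The generators. -/
  gen : ∀ i, V.obj (Y i)
  /-- The basis of `V(X)`. -/
  basis : ∀ X, Module.Basis (Σ i, (Y i ⟶ X)) R (V.obj X)
  basis_apply : ∀ X p, basis X p = (V.map p.2).hom (gen p.1)

lemma FreeBasis.projective {V : FIMod R} (b : V.FreeBasis) : Projective V where
  factors {W' W} φ e he := by
    have hs : ∀ X, Function.Surjective (e.app X).hom := fun X =>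
      (ModuleCat.epi_iff_surjective _).1 inferInstance
    choose v hv using fun i => hs (b.Y i) ((φ.app (b.Y i)).hom (b.gen i))
    let ψ : V ⟶ W' :=
      { app := fun X => ModuleCat.ofHom
          ((b.basis X).constr R fun p => (W'.map p.2).hom (v p.1))
        naturality := fun X Y f => by
          refine ModuleCat.hom_ext ((b.basis X).ext fun p => ?_)
          change (b.basis Y).constr R _ ((V.map f).hom (b.basis X p)) =
            (W'.map f).hom ((b.basis X).constr R _ (b.basis X p))
          have : (V.map f).hom (b.basis X p) = b.basis Y ⟨p.1, p.2 ≫ f⟩ := by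
            rw [b.basis_apply, b.basis_apply, map_comp_hom_apply]
          rw [this, Module.Basis.constr_basis, Module.Basis.constr_basis, map_comp_hom_apply] }
    refine ⟨ψ, ?_⟩
    ext X : 2
    refine ModuleCat.hom_ext ((b.basis X).ext fun p => ?_)
    change (e.app X).hom ((b.basis X).constr R _ (b.basis X p)) = (φ.app X).hom (b.basis X p)
    rw [Module.Basis.constr_basis, naturality_hom_apply, hv, b.basis_apply, naturality_hom_apply]

/-- The free `FI`-module on generators in the sets `Y i`. -/
def free (R : Type u) [CommRing R] (I : Type u) (Y : I → FI) : FIMod R where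
  obj X := ModuleCat.of R ((Σ i, (Y i ⟶ X)) →₀ R)
  map g := ModuleCat.ofHom (Finsupp.lmapDomain R R fun p => ⟨p.1, p.2 ≫ g⟩)
  map_id X := by
    refine ModuleCat.hom_ext (Finsupp.lhom_ext' fun f => LinearMap.ext_ring ?_)
    exact (Finsupp.mapDomain_single).trans (by rw [Category.comp_id]; rfl)
  map_comp g h := by
    refine ModuleCat.hom_ext (Finsupp.lhom_ext' fun f => LinearMap.ext_ring ?_)
    change Finsupp.mapDomain _ (Finsupp.single f 1) =
      Finsupp.mapDomain _ (Finsupp.mapDomain _ (Finsupp.single f (1 : R)))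
    simp only [Finsupp.mapDomain_single, Category.assoc]

/-- The element of the free `FI`-module given by a generator and an injection. -/
def free.elt {I : Type u} {Y : I → FI} {X : FI} (i : I) (f : Y i ⟶ X) : (free R I Y).obj X :=
  (Finsupp.single ⟨i, f⟩ 1 : (Σ i, (Y i ⟶ X)) →₀ R)

lemma free.map_elt {I : Type u} {Y : I → FI} {X X' : FI} (i : I) (f : Y i ⟶ X) (g : X ⟶ X') :
    ((free R I Y).map g).hom (free.elt i f) = free.elt i (f ≫ g) :=
  Finsupp.mapDomain_single

lemma free.hom_ext {I : Type u} {Y : I → FI} {X : FI} {M : ModuleCat.{u} R}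
    {φ ψ : (free R I Y).obj X ⟶ M}
    (h : ∀ i (f : Y i ⟶ X), φ.hom (free.elt i f) = ψ.hom (free.elt i f)) : φ = ψ :=
  ModuleCat.hom_ext (Finsupp.lhom_ext' fun p => LinearMap.ext_ring (h p.1 p.2))

/-- The standard basis of a free `FI`-module. -/
def free.freeBasis (I : Type u) (Y : I → FI) : (free R I Y).FreeBasis where
  ι := I
  Y := Y
  gen i := free.elt i (𝟙 _)
  basis X := Finsupp.basisSingleOne
  basis_apply X p := by
    rw [free.map_elt, Category.id_comp]
    exact congrFun (Finsupp.coe_basisSingleOne (R := R)) p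

lemma shift_free_bijective (I : Type u) (Y : I → FI) (X : FI) :
    Function.Bijective fun p : Σ j : Σ i, Option (Y i).carrier, (FI.compl (Y j.1) j.2 ⟶ X) =>
      (⟨p.1.1, FI.complHom (Y p.1.1) p.1.2 ≫ FI.succ.map p.2⟩ : Σ i, (Y i ⟶ FI.succ.obj X)) := by
  constructor
  · rintro ⟨⟨i, o⟩, f⟩ ⟨⟨i', o'⟩, f'⟩ h
    obtain ⟨rfl, h⟩ := Sigma.mk.inj_iff.1 h
    have := (FI.bijective_complHom_comp (Y i) X).1 (a₁ := ⟨o, f⟩) (a₂ := ⟨o', f'⟩) (eq_of_heq h)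
    cases this
    rfl
  · rintro ⟨i, F⟩
    obtain ⟨⟨o, f⟩, rfl⟩ := (FI.bijective_complHom_comp (Y i) X).2 F
    exact ⟨⟨⟨i, o⟩, f⟩, rfl⟩

/-- The basis of the values of the shift of a free `FI`-module. -/
def shiftBasis (R : Type u) [CommRing R] (I : Type u) (Y : I → FI) (X : FI) :
    Module.Basis (Σ j : Σ i, Option (Y i).carrier, (FI.compl (Y j.1) j.2 ⟶ X)) R
      ((free R I Y).obj (FI.succ.obj X)) :=
  ((free.freeBasis I Y).basis (FI.succ.obj X)).reindex
    (Equiv.ofBijective _ (shift_free_bijective I Y X)).symm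

lemma shiftBasis_apply (I : Type u) (Y : I → FI) (X : FI)
    (p : Σ j : Σ i, Option (Y i).carrier, (FI.compl (Y j.1) j.2 ⟶ X)) :
    shiftBasis R I Y X p = free.elt p.1.1 (FI.complHom (Y p.1.1) p.1.2 ≫ FI.succ.map p.2) :=
  (Module.Basis.reindex_apply _ _ _).trans
    (congrFun (Finsupp.coe_basisSingleOne (R := R)) _)

/-- The shift of a free `FI`-module is free. -/
def shiftFreeBasis (I : Type u) (Y : I → FI) : ((shift R).obj (free R I Y)).FreeBasis where
  ι := Σ i, Option (Y i).carrier
  Y j := FI.compl (Y j.1) j.2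
  gen j := free.elt j.1 (FI.complHom (Y j.1) j.2)
  basis X := shiftBasis R I Y X
  basis_apply X p := (shiftBasis_apply I Y X p).trans (free.map_elt _ _ _).symm

open Classical in
/-- The value of the retraction of `toShift` on the standard basis of a shifted free module. -/
def freeRetractionFun (R : Type u) [CommRing R] {I : Type u} {Y : I → FI} {X : FI}
    (p : Σ i, (Y i ⟶ FI.succ.obj X)) : (free R I Y).obj X :=
  if h : ∃ f : Y p.1 ⟶ X, f ≫ FI.toSucc.app X = p.2 then free.elt p.1 h.choose else 0

lemma freeRetractionFun_comp {I : Type u} {Y : I → FI} {X : FI} (i : I) (f : Y i ⟶ X) :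
    freeRetractionFun R (Y := Y) ⟨i, f ≫ FI.toSucc.app X⟩ = free.elt i f := by
  have h : ∃ f' : Y i ⟶ X, f' ≫ FI.toSucc.app X = f ≫ FI.toSucc.app X := ⟨f, rfl⟩
  exact (dif_pos h).trans (congrArg (free.elt i) (FI.comp_toSucc_injective h.choose_spec))

/-- The linear extension of `freeRetractionFun`. -/
def freeRetractionLin (R : Type u) [CommRing R] (I : Type u) (Y : I → FI) (X : FI) :
    (free R I Y).obj (FI.succ.obj X) →ₗ[R] (free R I Y).obj X :=
  Finsupp.linearCombination R
    (freeRetractionFun R : (Σ i, (Y i ⟶ FI.succ.obj X)) → (free R I Y).obj X)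

lemma freeRetractionLin_elt {I : Type u} {Y : I → FI} {X : FI} (i : I)
    (F : Y i ⟶ FI.succ.obj X) :
    freeRetractionLin R I Y X (free.elt i F) = freeRetractionFun R ⟨i, F⟩ :=
  (Finsupp.linearCombination_single R _ _).trans (one_smul R _)

/-- The retraction of `toShift` on a free `FI`-module, sending injections into `Option X` that hit
`none` to zero. -/
def freeRetraction (R : Type u) [CommRing R] (I : Type u) (Y : I → FI) :
    (shift R).obj (free R I Y) ⟶ free R I Y where
  app X := show (free R I Y).obj (FI.succ.obj X) ⟶ (free R I Y).obj X from
    ModuleCat.ofHom (freeRetractionLin R I Y X)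
  naturality X X' g := by
    refine free.hom_ext (M := (free R I Y).obj X') fun i F => ?_
    change freeRetractionLin R I Y X' (((free R I Y).map (FI.succ.map g)).hom (free.elt i F)) =
      ((free R I Y).map g).hom (freeRetractionLin R I Y X (free.elt i F))
    rw [free.map_elt, freeRetractionLin_elt, freeRetractionLin_elt]
    -- An injection hitting the new point still hits it after `FI.succ.map g`, so both sides vanish
    -- together.
    by_cases hF : ∃ f : Y i ⟶ X, f ≫ FI.toSucc.app X = F
    · obtain ⟨f, rfl⟩ := hF
      have : (f ≫ FI.toSucc.app X) ≫ FI.succ.map g = (f ≫ g) ≫ FI.toSucc.app X' := rfl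
      rw [this, freeRetractionFun_comp, freeRetractionFun_comp, free.map_elt]
    · have hF' : ¬∃ f : Y i ⟶ X', f ≫ FI.toSucc.app X' = F ≫ FI.succ.map g := fun ⟨_, hf⟩ =>
        hF (FI.exists_comp_toSucc_of_comp_map hf)
      exact (dif_neg hF').trans ((congrArg _ (dif_neg hF)).trans (map_zero _)).symm

lemma toShift_freeRetraction (I : Type u) (Y : I → FI) :
    (toShift R).app (free R I Y) ≫ freeRetraction R I Y = 𝟙 (free R I Y) := by
  ext X : 2
  refine free.hom_ext fun i f => ?_
  change freeRetractionLin R I Y X (((free R I Y).map (FI.toSucc.app X)).hom (free.elt i f)) =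
    free.elt i f
  rw [free.map_elt]
  exact (freeRetractionLin_elt i _).trans (freeRetractionFun_comp i f)

lemma exists_map_from_std (V : FIMod R) (X : FI) (x : V.obj X) :
    ∃ (n : ℕ) (f : FI.std n ⟶ X) (v : V.obj (FI.std n)), (V.map f).hom v = x := by
  let e : X.carrier ≃ Fin (Nat.card X.carrier) := Finite.equivFin X.carrier
  let f : X ⟶ FI.std (Nat.card X.carrier) := e.toEmbedding
  let f' : FI.std (Nat.card X.carrier) ⟶ X := e.symm.toEmbedding
  have hf : f ≫ f' = 𝟙 X := Function.Embedding.ext fun y => e.symm_apply_apply y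
  refine ⟨_, f', (V.map f).hom x, ?_⟩
  rw [← map_comp_hom_apply, hf, V.map_id]
  rfl

lemma epi_of_surjective {V W : FIMod R} (φ : V ⟶ W)
    (h : ∀ X, Function.Surjective (φ.app X).hom) : Epi φ :=
  have : ∀ X, Epi (φ.app X) := fun X => (ModuleCat.epi_iff_surjective _).2 (h X)
  NatTrans.epi_of_epi_app φ

lemma exists_epi_free (V : FIMod R) :
    ∃ (I : Type u) (Y : I → FI) (π : free R I Y ⟶ V), Epi π := by
  let I : Type u := Σ d : ℕ, V.obj (FI.std d)
  let Y : I → FI := fun s => FI.std s.1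
  let lc (X : FI) : ((Σ s, (Y s ⟶ X)) →₀ R) →ₗ[R] V.obj X :=
    Finsupp.linearCombination R fun p : Σ s, (Y s ⟶ X) => (V.map p.2).hom p.1.2
  have hlc : ∀ {X : FI} (i : I) (f : Y i ⟶ X), lc X (free.elt (R := R) (Y := Y) i f) =
      (V.map f).hom i.2 := fun i f =>
    (Finsupp.linearCombination_single R _ _).trans (one_smul R _)
  let π : free R I Y ⟶ V :=
    { app := fun X => ModuleCat.ofHom (lc X)
      naturality := fun X X' g => free.hom_ext fun i f => by
        change lc X' (((free R I Y).map g).hom (free.elt (R := R) i f)) =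
          (V.map g).hom (lc X (free.elt (R := R) i f))
        rw [free.map_elt, hlc, hlc]
        exact map_comp_hom_apply V f g i.2 }
  refine ⟨I, Y, π, epi_of_surjective π fun X x => ?_⟩
  obtain ⟨n, f, v, rfl⟩ := exists_map_from_std V X x
  exact ⟨free.elt (R := R) (Y := Y) (⟨n, v⟩ : I) f, hlc ⟨n, v⟩ f⟩

/-- A projective is a retract of a free `FI`-module, and naturality of `toShift` transports the
retraction. -/
lemma exists_retraction_toShift (P : FIMod R) [Projective P] :
    ∃ r : (shift R).obj P ⟶ P, (toShift R).app P ≫ r = 𝟙 P := by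
  obtain ⟨I, Y, π, hπ⟩ := exists_epi_free P
  let s := Projective.factorThru (𝟙 P) π
  have hs : s ≫ π = 𝟙 P := Projective.factorThru_comp _ _
  refine ⟨(shift R).map s ≫ freeRetraction R I Y ≫ π, ?_⟩
  have h : (toShift R).app P ≫ (shift R).map s = s ≫ (toShift R).app (free R I Y) :=
    ((toShift R).naturality s).symm
  have h' : (toShift R).app P ≫ (shift R).map s ≫ freeRetraction R I Y = s := by
    rw [← Category.assoc, h]
    exact (Category.assoc _ _ _).trans
      ((congrArg (s ≫ ·) (toShift_freeRetraction I Y)).trans (Category.comp_id s))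
  rw [← Category.assoc, ← Category.assoc, Category.assoc _ _ (freeRetraction R I Y)]
  exact (congrArg (· ≫ π) h').trans hs

instance : (shift R).PreservesProjectiveObjects where
  projective_obj {P} hP := by
    obtain ⟨I, Y, π, hπ⟩ := exists_epi_free P
    let s := Projective.factorThru (𝟙 P) π
    have hs : s ≫ π = 𝟙 P := Projective.factorThru_comp _ _
    have := (shiftFreeBasis (R := R) I Y).projective
    exact (Retract.mk ((shift R).map s) ((shift R).map π)
      (by rw [← Functor.map_comp, hs, CategoryTheory.Functor.map_id])).projective

/-! ### Behaviour of `J` and of `V / JV` under the shift. -/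

lemma map_mem_J (V : FIMod R) {Y X : FI} (h : Nat.card Y.carrier < Nat.card X.carrier)
    (f : Y ⟶ X) (v : V.obj Y) : (V.map f).hom v ∈ V.J X := by
  let e : Y.carrier ≃ Fin (Nat.card Y.carrier) := Finite.equivFin Y.carrier
  let g : Y ⟶ FI.std (Nat.card Y.carrier) := e.toEmbedding
  let g' : FI.std (Nat.card Y.carrier) ⟶ Y := e.symm.toEmbedding
  have hg : g ≫ g' ≫ f = f :=
    Function.Embedding.ext fun y => congrArg f.toFun (e.symm_apply_apply y)
  refine Submodule.subset_span ⟨_, h, g' ≫ f, (V.map g).hom v, ?_⟩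
  rw [← map_comp_hom_apply, hg]

lemma J_eq_bot (V : FIMod R) (X : FI) [IsEmpty X.carrier] : V.J X = ⊥ := by
  rw [eq_bot_iff]
  refine Submodule.span_le.2 ?_
  rintro _ ⟨m, hm, -⟩
  rw [Nat.card_of_isEmpty] at hm
  exact absurd hm (Nat.not_lt_zero m)

lemma J_le_map_app {V W : FIMod R} (φ : V ⟶ W) (X : FI)
    (h : ∀ Y, Function.Surjective (φ.app Y).hom) : W.J X ≤ (V.J X).map (φ.app X).hom := by
  refine Submodule.span_le.2 ?_
  rintro _ ⟨m, hm, f, w, rfl⟩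
  obtain ⟨v, rfl⟩ := h _ w
  exact ⟨(V.map f).hom v, Submodule.subset_span ⟨m, hm, f, v, rfl⟩, naturality_hom_apply φ f v⟩

/-- The submodule `(JΣV)(X)` of `(ΣV)(X) = V(X ⊔ {∗})`. -/
def shiftJ (V : FIMod R) (X : FI) : Submodule R (V.obj (FI.succ.obj X)) :=
  ((shift R).obj V).J X

lemma J_shift_le (V : FIMod R) (X : FI) :
    V.shiftJ X ≤ V.J (FI.succ.obj X) := by
  refine Submodule.span_le.2 ?_
  rintro _ ⟨m, hm, f, v, rfl⟩
  refine map_mem_J V ?_ (FI.succ.map f) v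
  change Nat.card (Option (Fin m)) < Nat.card (Option X.carrier)
  rw [Finite.card_option, Finite.card_option, Nat.card_fin]
  exact Nat.succ_lt_succ hm

/-- An injection into `X ⊔ {∗}` either misses the new point and so factors through `X`, or hits it
from some `y`; in the second case it is the shift of an injection of the smaller set without `y`.
This makes the sequence of `shortExact_coinv` exact in the middle. -/
lemma J_succ_le (V : FIMod R) (X : FI) :
    V.J (FI.succ.obj X) ≤ V.shiftJ X ⊔
      LinearMap.range (V.map (FI.toSucc.app X)).hom := by
  refine Submodule.span_le.2 ?_
  rintro _ ⟨m, hm, F, v, rfl⟩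
  obtain ⟨⟨o, f⟩, rfl⟩ := (FI.bijective_complHom_comp (FI.std m) X).2 F
  cases o with
  | none =>
    obtain ⟨f', hf'⟩ := FI.exists_comp_toSucc (F := FI.complHom (FI.std m) none ≫ FI.succ.map f)
      fun z => by
        rw [FI.complHom_comp_of_ne f (Option.some_ne_none z)]
        exact Option.some_ne_none _
    refine Submodule.mem_sup_right ⟨(V.map f').hom v, ?_⟩
    rw [← map_comp_hom_apply]
    exact congrArg (fun k => (V.map k).hom v) hf'
  | some y =>
    refine Submodule.mem_sup_left ?_
    have hm' : m ≤ Nat.card X.carrier := by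
      have h : m < Nat.card (Option X.carrier) := hm
      rw [Finite.card_option] at h
      exact Nat.le_of_lt_succ h
    have hc : Nat.card (FI.compl (FI.std m) (some y)).carrier < m := by
      refine lt_of_lt_of_eq (Finite.card_subtype_lt (x := y) ?_) (Nat.card_fin m)
      exact not_not.2 rfl
    have := map_mem_J ((shift R).obj V) (hc.trans_le hm') f
      ((V.map (FI.complHom (FI.std m) (some y))).hom v)
    rw [map_comp_hom_apply]
    exact this

/-- The functor `V ↦ (V / JV)(X)`. -/
def coinv (R : Type u) [CommRing R] (X : FI) : FIMod R ⥤ ModuleCat.{u} R :=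
  H0 R ⋙ (evaluation FI (ModuleCat.{u} R)).obj X

instance (X : FI) : (coinv R X).Additive :=
  inferInstanceAs (H0 R ⋙ (evaluation FI (ModuleCat.{u} R)).obj X).Additive

lemma surjective_app {V W : FIMod R} (φ : V ⟶ W) [Epi φ] (X : FI) :
    Function.Surjective (φ.app X).hom :=
  (ModuleCat.epi_iff_surjective _).1 inferInstance

lemma injective_app {V W : FIMod R} (φ : V ⟶ W) [Mono φ] (X : FI) :
    Function.Injective (φ.app X).hom :=
  (ModuleCat.mono_iff_injective _).1 inferInstance

lemma exact_app {S : ShortComplex (FIMod R)} (hS : S.Exact) (X : FI) :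
    Function.Exact (S.f.app X).hom (S.g.app X).hom :=
  (ShortComplex.ShortExact.moduleCat_exact_iff_function_exact _).1
    (hS.map ((evaluation FI (ModuleCat.{u} R)).obj X))

instance (X : FI) : PreservesFiniteColimits (coinv R X) := by
  refine ((coinv R X).preservesFiniteColimits_tfae.out 0 3).1 ?_
  refine fun S hS => ⟨?_, ?_⟩
  · have := hS.epi_g
    refine (ShortComplex.ShortExact.moduleCat_exact_iff_function_exact _).2 fun x => ?_
    induction x using Submodule.Quotient.induction_on with | H x => ?_
    constructor
    · intro hx
      have hx' : (S.g.app X).hom x ∈ S.X₃.J X := (Submodule.Quotient.mk_eq_zero _).1 hx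
      obtain ⟨j, hj, hjx⟩ := J_le_map_app S.g X (surjective_app S.g) hx'
      obtain ⟨w, hw⟩ := (exact_app hS.exact X (x - j)).1 (by rw [map_sub, hjx, sub_self])
      refine ⟨Submodule.Quotient.mk w, ?_⟩
      refine (Submodule.Quotient.eq (S.X₂.J X)).2 ?_
      rw [hw, sub_sub_cancel_left]
      exact neg_mem hj
    · rintro ⟨w, hw⟩
      induction w using Submodule.Quotient.induction_on with | H w => ?_
      rw [← hw]
      refine (Submodule.Quotient.mk_eq_zero _).2 ?_
      have : (S.g.app X).hom ((S.f.app X).hom w) = 0 := (exact_app hS.exact X).apply_apply_eq_zero w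
      change (S.g.app X).hom ((S.f.app X).hom w) ∈ _
      rw [this]
      exact zero_mem _
  · have := hS.epi_g
    refine (ModuleCat.epi_iff_surjective _).2 fun x => ?_
    induction x using Submodule.Quotient.induction_on with | H x => ?_
    obtain ⟨y, rfl⟩ := surjective_app S.g X x
    exact ⟨Submodule.Quotient.mk y, rfl⟩

instance (X : FI) [IsEmpty X.carrier] : (coinv R X).PreservesMonomorphisms where
  preserves {V W} φ hφ := by
    refine (ModuleCat.mono_iff_injective _).2 ((injective_iff_map_eq_zero _).2 fun x hx => ?_)
    induction x using Submodule.Quotient.induction_on with | H x => ?_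
    have hx' : (φ.app X).hom x ∈ W.J X := (Submodule.Quotient.mk_eq_zero _).1 hx
    rw [J_eq_bot, Submodule.mem_bot] at hx'
    rw [(injective_iff_map_eq_zero _).1 (injective_app φ X) x hx']
    rfl

/-- The map `(V / JV)(X) → (ΣV / JΣV)(X)`. -/
def coinvToShift (R : Type u) [CommRing R] (X : FI) : coinv R X ⟶ shift R ⋙ coinv R X where
  app V := (coinv R X).map ((toShift R).app V)
  naturality V W φ := by
    change (coinv R X).map φ ≫ (coinv R X).map _ = (coinv R X).map _ ≫ (coinv R X).map _
    rw [← Functor.map_comp, ← Functor.map_comp]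
    exact congrArg _ ((toShift R).naturality φ)

/-- The map `(ΣV / JΣV)(X) → (V / JV)(X ⊔ {∗})`. -/
def shiftToCoinv (R : Type u) [CommRing R] (X : FI) :
    shift R ⋙ coinv R X ⟶ coinv R (FI.succ.obj X) where
  app V := ModuleCat.ofHom (Submodule.mapQ (M := V.obj (FI.succ.obj X))
    (M₂ := V.obj (FI.succ.obj X)) (V.shiftJ X) (V.J (FI.succ.obj X)) LinearMap.id (J_shift_le V X) :
      (V.obj (FI.succ.obj X) ⧸ V.shiftJ X) →ₗ[R] _)
  naturality V W φ := by
    refine ModuleCat.hom_ext (LinearMap.ext fun x => ?_)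
    induction x using Submodule.Quotient.induction_on with | H x => ?_
    rfl

lemma coinvToShift_comp_shiftToCoinv (X : FI) (V : FIMod R) :
    (coinvToShift R X).app V ≫ (shiftToCoinv R X).app V = 0 := by
  refine ModuleCat.hom_ext (LinearMap.ext fun x => ?_)
  induction x using Submodule.Quotient.induction_on with | H x => ?_
  refine (Submodule.Quotient.mk_eq_zero _).2 (map_mem_J V ?_ (FI.toSucc.app X) x)
  exact lt_of_lt_of_eq (Nat.lt_succ_self _) (Finite.card_option (α := X.carrier)).symm

/-- Projectivity is needed only on the left, where the retraction of `toShift` provides injectivity.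
-/
lemma shortExact_coinv (X : FI) (P : FIMod R) [Projective P] :
    (ShortComplex.mk _ _ (coinvToShift_comp_shiftToCoinv X P)).ShortExact where
  exact := by
    refine (ShortComplex.ShortExact.moduleCat_exact_iff_function_exact _).2 fun x => ?_
    induction x using Submodule.Quotient.induction_on with | H x => ?_
    constructor
    · intro hx
      have hx' := J_succ_le P X ((Submodule.Quotient.mk_eq_zero (P.J (FI.succ.obj X))).1 hx)
      obtain ⟨j, hj, _, ⟨w, rfl⟩, rfl⟩ := Submodule.mem_sup.1 hx'
      refine ⟨Submodule.Quotient.mk w, (Submodule.Quotient.eq (P.shiftJ X)).2 ?_⟩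
      have key : ∀ a b : P.obj (FI.succ.obj X), b ∈ P.shiftJ X → a - (b + a) ∈ P.shiftJ X :=
        fun a b hb => by rw [sub_add_cancel_right]; exact neg_mem hb
      exact key _ j hj
    · rintro ⟨w, hw⟩
      rw [← hw]
      exact congrArg (fun k => k.hom w) (coinvToShift_comp_shiftToCoinv X P)
  mono_f := by
    obtain ⟨r, hr⟩ := exists_retraction_toShift P
    have h : (coinvToShift R X).app P ≫ (coinv R X).map r = 𝟙 _ :=
      ((coinv R X).map_comp _ _).symm.trans ((congrArg _ hr).trans ((coinv R X).map_id P))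
    exact mono_of_mono_fac h
  epi_g := by
    refine (ModuleCat.epi_iff_surjective _).2 fun x => ?_
    induction x using Submodule.Quotient.induction_on with | H x => ?_
    exact ⟨Submodule.Quotient.mk (p := ((shift R).obj P).J X) x, rfl⟩

end

end FIMod

/-- The length of the middle term of an exact sequence is at most the sum of the outer ones. -/
lemma Module.length_le_add_of_exact {R B C D : Type*} [CommRing R] [AddCommGroup B]
    [AddCommGroup C] [AddCommGroup D] [Module R B] [Module R C] [Module R D] {g : B →ₗ[R] C}
    {δ : C →ₗ[R] D} (h : Function.Exact g δ) :
    Module.length R C ≤ Module.length R B + Module.length R D := by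
  rw [Module.length_eq_add_of_exact (LinearMap.range g).subtype δ.rangeRestrict
    (Submodule.subtype_injective _) δ.surjective_rangeRestrict (fun x => by
      rw [Submodule.coe_subtype, Subtype.range_coe, SetLike.mem_coe, LinearMap.mem_range,
        ← Set.mem_range, ← h x, Subtype.ext_iff]
      rfl)]
  exact add_le_add (Module.length_le_of_surjective g.rangeRestrict g.surjective_rangeRestrict)
    (Module.length_le_of_injective (LinearMap.range δ).subtype (Submodule.subtype_injective _))

/-! ### The long exact sequence of the shift and lengths of `FI`-homology. -/

namespace FIMod

noncomputable section

variable {R : Type u} [CommRing R]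

instance : PreservesFiniteLimits (shift R) :=
  inferInstanceAs (PreservesFiniteLimits
    ((Functor.whiskeringLeft FI FI (ModuleCat.{u} R)).obj FI.succ))

instance : PreservesFiniteColimits (shift R) :=
  inferInstanceAs (PreservesFiniteColimits
    ((Functor.whiskeringLeft FI FI (ModuleCat.{u} R)).obj FI.succ))

/-- The short exact sequence of complexes relating the values of `coinv` on a resolution. -/
def coinvSequence (X : FI) (K : ChainComplex (FIMod R) ℕ) :
    ShortComplex (ChainComplex (ModuleCat.{u} R) ℕ) :=
  ShortComplex.mk ((NatTrans.mapHomologicalComplex (coinvToShift R X) _).app K)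
    ((NatTrans.mapHomologicalComplex (shiftToCoinv R X) _).app K) (by
      ext i : 1
      exact coinvToShift_comp_shiftToCoinv X (K.X i))

lemma shortExact_coinvSequence (X : FI) (K : ChainComplex (FIMod R) ℕ)
    (hK : ∀ i, Projective (K.X i)) : (coinvSequence X K).ShortExact :=
  HomologicalComplex.shortExact_of_degreewise_shortExact _ fun i =>
    have := hK i
    shortExact_coinv X (K.X i)

/-- The left derived functors of `coinv`. -/
abbrev tor (R : Type u) [CommRing R] (X : FI) (a : ℕ) : FIMod R ⥤ ModuleCat.{u} R :=
  (coinv R X).leftDerived a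

section

variable {V : FIMod R} (P : ProjectiveResolution V) (X : FI) (a : ℕ)

/-- The first homology of `coinvSequence` computes `tor` of `V`. -/
def torIsoX₁ : (tor R X a).obj V ≅ (coinvSequence X P.complex).X₁.homology a :=
  P.isoLeftDerivedObj (coinv R X) a

/-- The second homology of `coinvSequence` computes `tor` of the shift of `V`. -/
def torIsoX₂ : (tor R X a).obj ((shift R).obj V) ≅ (coinvSequence X P.complex).X₂.homology a :=
  ((shift R).mapProjectiveResolution P).isoLeftDerivedObj (coinv R X) a

/-- The third homology of `coinvSequence` computes `tor` of `V` on a larger set. -/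
def torIsoX₃ : (tor R (FI.succ.obj X) a).obj V ≅ (coinvSequence X P.complex).X₃.homology a :=
  P.isoLeftDerivedObj (coinv R (FI.succ.obj X)) a

/-- This homology map is the derived functor applied to `V → ΣV`, because `P → ΣP` lifts that map to
projective resolutions. -/
lemma homologyMap_f_eq_zero (h : (toShift R).app V = 0) :
    HomologicalComplex.homologyMap (coinvSequence X P.complex).f a = 0 := by
  let φ : P.complex ⟶ ((shift R).mapProjectiveResolution P).complex :=
    (NatTrans.mapHomologicalComplex (toShift R) _).app P.complex
  have := P.isoLeftDerivedObj_hom_naturality ((toShift R).app V)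
    ((shift R).mapProjectiveResolution P) φ (by
      have h1 : ((shift R).mapProjectiveResolution P).π.f 0 = (shift R).map (P.π.f 0) := by
        have h2 := HomologicalComplex.singleMapHomologicalComplex_hom_app_self (shift R)
          (ComplexShape.down ℕ) 0 V
        rw [ChainComplex.single₀ObjXSelf, ChainComplex.single₀ObjXSelf] at h2
        refine (congrArg ((shift R).map (P.π.f 0) ≫ ·) h2).trans ?_
        refine (congrArg ((shift R).map (P.π.f 0) ≫ ·)
          ((Category.comp_id _).trans ((shift R).map_id V))).trans (Category.comp_id _)
      rw [h1]
      exact ((toShift R).naturality (P.π.f 0)).symm) (coinv R X) a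
  rw [h] at this
  have h₀ := P.isoLeftDerivedObj_hom_naturality (0 : V ⟶ (shift R).obj V)
    ((shift R).mapProjectiveResolution P) 0 (zero_comp.trans comp_zero.symm)
    (coinv R X) a
  have h' := (cancel_epi (P.isoLeftDerivedObj (coinv R X) a).hom).1 (this.symm.trans h₀)
  exact h'.trans (CategoryTheory.Functor.map_zero _ _ _)

end

lemma length_tor_succ_succ_le (V : FIMod R) (X : FI) (a : ℕ) :
    Module.length R ((tor R (FI.succ.obj X) (a + 1)).obj V) ≤
      Module.length R ((tor R X (a + 1)).obj ((shift R).obj V)) +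
        Module.length R ((tor R X a).obj V) := by
  let P := projectiveResolution V
  have hS := shortExact_coinvSequence X P.complex P.projective
  rw [(torIsoX₃ P X (a + 1)).toLinearEquiv.length_eq,
    (torIsoX₂ P X (a + 1)).toLinearEquiv.length_eq, (torIsoX₁ P X a).toLinearEquiv.length_eq]
  exact Module.length_le_add_of_exact
    ((ShortComplex.ShortExact.moduleCat_exact_iff_function_exact _).1
      (hS.homology_exact₃ (a + 1) a (by simp)))

/-- The maps induced by `V → ΣV` vanish, so the long exact sequence splits into short exact ones. -/
lemma length_tor_succ_succ (V : FIMod R) (h : (toShift R).app V = 0) (X : FI) (a : ℕ) :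
    Module.length R ((tor R (FI.succ.obj X) (a + 1)).obj V) =
      Module.length R ((tor R X (a + 1)).obj ((shift R).obj V)) +
        Module.length R ((tor R X a).obj V) := by
  let P := projectiveResolution V
  have hS := shortExact_coinvSequence X P.complex P.projective
  rw [(torIsoX₃ P X (a + 1)).toLinearEquiv.length_eq,
    (torIsoX₂ P X (a + 1)).toLinearEquiv.length_eq, (torIsoX₁ P X a).toLinearEquiv.length_eq]
  have h₂ := hS.homology_exact₂ (a + 1)
  have h₃ := hS.homology_exact₃ (a + 1) a (by simp)
  have h₁ := hS.homology_exact₁ (a + 1) a (by simp)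
  have hm : Mono (HomologicalComplex.homologyMap (coinvSequence X P.complex).g (a + 1)) :=
    (ShortComplex.exact_iff_mono _ (homologyMap_f_eq_zero P X (a + 1) h)).1 h₂
  have he : Epi (hS.δ (a + 1) a (by simp)) :=
    (ShortComplex.exact_iff_epi _ (homologyMap_f_eq_zero P X a h)).1 h₁
  exact Module.length_eq_add_of_exact _ _ ((ModuleCat.mono_iff_injective _).1 hm)
    ((ModuleCat.epi_iff_surjective _).1 he)
    ((ShortComplex.ShortExact.moduleCat_exact_iff_function_exact _).1 h₃)

lemma length_tor_zero (V : FIMod R) (X : FI) :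
    Module.length R ((tor R X 0).obj V) = Module.length R (V.obj X ⧸ V.J X) :=
  ((coinv R X).leftDerivedZeroIsoSelf.app V).toLinearEquiv.length_eq

lemma length_tor_succ_zero_le (V : FIMod R) (X : FI) :
    Module.length R ((tor R (FI.succ.obj X) 0).obj V) ≤
      Module.length R ((tor R X 0).obj ((shift R).obj V)) := by
  rw [length_tor_zero, length_tor_zero]
  refine Module.length_le_of_surjective ((shiftToCoinv R X).app V).hom fun x => ?_
  induction x using Submodule.Quotient.induction_on with | H x => ?_
  exact ⟨Submodule.Quotient.mk (p := ((shift R).obj V).J X) x, rfl⟩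

lemma length_tor_succ_zero (V : FIMod R) (h : (toShift R).app V = 0) (X : FI) :
    Module.length R ((tor R (FI.succ.obj X) 0).obj V) =
      Module.length R ((tor R X 0).obj ((shift R).obj V)) := by
  have hJ : V.J (FI.succ.obj X) = V.shiftJ X := by
    refine le_antisymm ((J_succ_le V X).trans (sup_le le_rfl ?_)) (J_shift_le V X)
    rintro _ ⟨w, rfl⟩
    have h0 : V.map (FI.toSucc.app X) = 0 := congrArg (fun k : V ⟶ (shift R).obj V => k.app X) h
    rw [h0]
    exact zero_mem _
  rw [length_tor_zero, length_tor_zero, hJ]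
  rfl

/-- A model of the set with `n` elements, built by successively adjoining points. -/
def _root_.FI.iter : ℕ → FI
  | 0 => FI.std 0
  | n + 1 => FI.succ.obj (FI.iter n)

lemma _root_.FI.card_iter (n : ℕ) : Nat.card (FI.iter n).carrier = n := by
  induction n with
  | zero => exact Nat.card_fin 0
  | succ n ih => exact (Finite.card_option (α := (FI.iter n).carrier)).trans (congrArg Nat.succ ih)

instance : IsEmpty (FI.iter 0).carrier := inferInstanceAs (IsEmpty (Fin 0))

lemma length_eq_zero_of_isZero {M : ModuleCat.{u} R} (h : IsZero M) : Module.length R M = 0 :=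
  Module.length_eq_zero_iff.2 (ModuleCat.subsingleton_of_isZero h)

/-- Induction on `n` by Pascal's rule, using that `ΣV` on `n` points is `V` on `n + 1`. On the empty
set `J` is zero, so higher derived functors vanish there. -/
lemma length_tor_le (n a : ℕ) (V : FIMod R) :
    Module.length R ((tor R (FI.iter n) a).obj V) ≤
      n.choose a * Module.length R (V.obj (FI.iter (n - a))) := by
  induction n generalizing a V with
  | zero =>
    cases a with
    | zero =>
      rw [length_tor_zero, Nat.choose_self, Nat.cast_one, one_mul]
      exact Module.length_le_of_surjective _ (Submodule.mkQ_surjective _)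
    | succ a =>
      rw [length_eq_zero_of_isZero
        (isZero_leftDerived_succ_of_preservesMonomorphisms (coinv R (FI.iter 0)) a V)]
      exact zero_le
  | succ n ih =>
    cases a with
    | zero =>
      refine (length_tor_succ_zero_le V (FI.iter n)).trans ((ih 0 _).trans ?_)
      rw [Nat.choose_zero_right, Nat.choose_zero_right]
      exact le_rfl
    | succ a =>
      refine (length_tor_succ_succ_le V (FI.iter n) a).trans
        ((add_le_add (ih (a + 1) _) (ih a V)).trans ?_)
      rw [Nat.choose_succ_succ, Nat.add_sub_add_right, Nat.cast_add, add_mul, add_comm]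
      refine add_le_add le_rfl ?_
      -- If `a + 1 > n`, the truncated subtraction gives the wrong set, but the binomial coefficient
      -- is zero, even against an infinite length.
      by_cases h : a + 1 ≤ n
      · have : n - a = n - (a + 1) + 1 := by omega
        rw [this]
        exact le_rfl
      · rw [Nat.choose_eq_zero_of_lt (not_le.1 h), Nat.cast_zero, zero_mul]
        exact zero_le

/-- All maps of `V` induced by non-bijective injections are zero. -/
def ProperMapsVanish (V : FIMod R) : Prop :=
  ∀ ⦃X Y : FI⦄ (f : X ⟶ Y), Nat.card X.carrier < Nat.card Y.carrier → V.map f = 0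

lemma ProperMapsVanish.toShift_eq_zero {V : FIMod R} (hV : V.ProperMapsVanish) :
    (toShift R).app V = 0 := by
  ext X : 2
  exact hV (FI.toSucc.app X)
    (lt_of_lt_of_eq (Nat.lt_succ_self _) (Finite.card_option (α := X.carrier)).symm)

lemma ProperMapsVanish.shift {V : FIMod R} (hV : V.ProperMapsVanish) :
    ((shift R).obj V).ProperMapsVanish := fun X Y f h => hV (FI.succ.map f) (by
  change Nat.card (Option X.carrier) < Nat.card (Option Y.carrier)
  rw [Finite.card_option, Finite.card_option]
  exact Nat.succ_lt_succ h)

lemma length_tor_eq (n a : ℕ) (V : FIMod R) (hV : V.ProperMapsVanish) :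
    Module.length R ((tor R (FI.iter n) a).obj V) =
      n.choose a * Module.length R (V.obj (FI.iter (n - a))) := by
  induction n generalizing a V with
  | zero =>
    cases a with
    | zero =>
      rw [length_tor_zero, Nat.choose_self, Nat.cast_one, one_mul, J_eq_bot]
      exact (Submodule.quotEquivOfEqBot _ rfl).length_eq
    | succ a =>
      rw [length_eq_zero_of_isZero
        (isZero_leftDerived_succ_of_preservesMonomorphisms (coinv R (FI.iter 0)) a V)]
      simp
  | succ n ih =>
    cases a with
    | zero =>
      refine (length_tor_succ_zero V hV.toShift_eq_zero (FI.iter n)).trans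
        ((ih 0 _ hV.shift).trans ?_)
      rw [Nat.choose_zero_right, Nat.choose_zero_right]
      rfl
    | succ a =>
      refine (length_tor_succ_succ V hV.toShift_eq_zero (FI.iter n) a).trans
        ((congrArg₂ (· + ·) (ih (a + 1) _ hV.shift) (ih a V hV)).trans ?_)
      rw [Nat.choose_succ_succ, Nat.add_sub_add_right, Nat.cast_add, add_mul, add_comm]
      refine congrArg₂ (· + ·) rfl ?_
      by_cases h : a + 1 ≤ n
      · have : n - a = n - (a + 1) + 1 := by omega
        rw [this]
        rfl
      · rw [Nat.choose_eq_zero_of_lt (not_le.1 h), Nat.cast_zero, zero_mul, zero_mul]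

/-- The values of `FI`-homology are the derived functors of `coinv`. -/
lemma nonempty_homology_obj_iso (V : FIMod R) (X : FI) (a : ℕ) :
    Nonempty (((homology R a).obj V).obj X ≅ (tor R X a).obj V) := by
  let P := projectiveResolution V
  let K := ((H0 R).mapHomologicalComplex (ComplexShape.down ℕ)).obj P.complex
  have e₁ := ((evaluation FI (ModuleCat.{u} R)).obj X).mapIso (P.isoLeftDerivedObj (H0 R) a)
  -- Evaluation at `X` is exact, so it commutes with homology.
  have e₂ := ((K.sc a).mapHomologyIso ((evaluation FI (ModuleCat.{u} R)).obj X))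
  have e₃ := P.isoLeftDerivedObj (coinv R X) a
  exact ⟨e₁ ≪≫ e₂.symm ≪≫ e₃.symm⟩

end

end FIMod

/-- Over a nonzero finitely generated module there is a maximal ideal with nonzero fibre. -/
lemma Ideal.exists_isMaximal_smul_top_ne_top (R M : Type*) [CommRing R] [AddCommGroup M]
    [Module R M] [Module.Finite R M] [Nontrivial M] :
    ∃ I : Ideal R, I.IsMaximal ∧ I • (⊤ : Submodule R M) ≠ ⊤ := by
  have hann : Module.annihilator R M ≠ ⊤ := fun h =>
    not_subsingleton M (Module.annihilator_eq_top_iff.1 h)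
  obtain ⟨I, hI, hle⟩ := Ideal.exists_le_maximal _ hann
  refine ⟨I, hI, fun h => ?_⟩
  -- Nakayama: if `IM = M`, some `r ≡ 1` modulo `I` annihilates `M`; but `I` contains the
  -- annihilator.
  obtain ⟨r, hr, hr'⟩ := Submodule.exists_sub_one_mem_and_smul_eq_zero_of_fg_of_le_smul I
    (⊤ : Submodule R M) Module.Finite.fg_top h.ge
  have hrI : r ∈ I := hle (Module.mem_annihilator.2 fun x => hr' x trivial)
  exact hI.ne_top ((Ideal.eq_top_iff_one I).2 ((Submodule.sub_mem_iff_right I hrI).1 hr))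

lemma Module.length_quotient_smul_top_ne_top (R M : Type*) [CommRing R] [AddCommGroup M]
    [Module R M] [Module.Finite R M] (I : Ideal R) (hI : I.IsMaximal) :
    Module.length R (M ⧸ (I • ⊤ : Submodule R M)) ≠ ⊤ := by
  let _ := Ideal.Quotient.field I
  have : Module.Finite (R ⧸ I) (M ⧸ (I • ⊤ : Submodule R M)) :=
    Module.Finite.of_restrictScalars_finite R _ _
  rw [Module.length_eq_of_surjective (S := R) (R := R ⧸ I) Ideal.Quotient.mk_surjective]
  exact Module.length_ne_top

/-! ### Reduction modulo a maximal ideal, truncation, and the two bounds on regularity. -/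

namespace FIMod

noncomputable section

variable {R : Type u} [CommRing R]

/-- A sub-`FI`-module. -/
structure Sub (V : FIMod R) where
  /-- The submodules of the values. -/
  obj : ∀ X, Submodule R (V.obj X)
  map_le : ∀ {X Y : FI} (f : X ⟶ Y), obj X ≤ (obj Y).comap (V.map f).hom

namespace Sub

variable {V : FIMod R} (N : V.Sub)

/-- A sub-`FI`-module as an `FI`-module. -/
def toFIMod : FIMod R where
  obj X := ModuleCat.of R (N.obj X)
  map f := ModuleCat.ofHom ((V.map f).hom.restrict (N.map_le f))
  map_id X := by
    refine ModuleCat.hom_ext (LinearMap.ext fun x => Subtype.ext ?_)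
    exact congrArg (fun k => k.hom x.1) (V.map_id X)
  map_comp f g := by
    refine ModuleCat.hom_ext (LinearMap.ext fun x => Subtype.ext ?_)
    exact V.map_comp_hom_apply f g x.1

/-- The quotient by a sub-`FI`-module. -/
def quotient : FIMod R where
  obj X := ModuleCat.of R (V.obj X ⧸ N.obj X)
  map {X Y} f := ModuleCat.ofHom ((N.obj X).mapQ (N.obj Y) (V.map f).hom (N.map_le f))
  map_id X := by
    ext x
    exact congrArg (Submodule.Quotient.mk (p := N.obj X)) (by rw [V.map_id]; rfl)
  map_comp {X Y Z} f g := by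
    ext x
    exact congrArg (Submodule.Quotient.mk (p := N.obj Z)) (V.map_comp_hom_apply f g x)

/-- The short complex of a sub-`FI`-module and its quotient. -/
def shortComplex : ShortComplex (FIMod R) where
  X₁ := N.toFIMod
  X₂ := V
  X₃ := N.quotient
  f := { app := fun X => ModuleCat.ofHom (N.obj X).subtype }
  g := { app := fun X => ModuleCat.ofHom (N.obj X).mkQ }
  zero := by
    ext X : 2
    refine ModuleCat.hom_ext (LinearMap.ext fun x => ?_)
    exact (Submodule.Quotient.mk_eq_zero _).2 x.2

lemma shortExact : N.shortComplex.ShortExact where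
  exact := by
    rw [ShortComplex.exact_iff_isZero_homology, Functor.isZero_iff]
    intro X
    refine IsZero.of_iso ?_
      (N.shortComplex.mapHomologyIso ((evaluation FI (ModuleCat.{u} R)).obj X)).symm
    rw [← ShortComplex.exact_iff_isZero_homology]
    refine (ShortComplex.ShortExact.moduleCat_exact_iff_function_exact _).2 fun x => ?_
    refine (Submodule.Quotient.mk_eq_zero (N.obj X)).trans ⟨fun h => ⟨⟨x, h⟩, rfl⟩, ?_⟩
    rintro ⟨y, rfl⟩
    exact y.2
  mono_f := by
    have : ∀ X, Mono (N.shortComplex.f.app X) := fun X =>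
      (ModuleCat.mono_iff_injective _).2 Subtype.val_injective
    exact NatTrans.mono_of_mono_app _
  epi_g := epi_of_surjective _ fun X => Submodule.mkQ_surjective _

end Sub

lemma FinitelyGenerated.finite {V : FIMod R} (h : V.FinitelyGenerated) (X : FI) :
    Module.Finite R (V.obj X) := by
  obtain ⟨k, n, v, hv⟩ := h
  refine ⟨?_⟩
  rw [← hv X]
  refine Submodule.fg_span ?_
  have : ∀ i, Finite (FI.std (n i) ⟶ X) := fun i =>
    inferInstanceAs (Finite (Fin (n i) ↪ X.carrier))
  refine (Set.finite_range fun p : Σ i, (FI.std (n i) ⟶ X) => (V.map p.2).hom (v p.1)).subset ?_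
  rintro _ ⟨i, f, rfl⟩
  exact ⟨⟨i, f⟩, rfl⟩

lemma _root_.FI.nonempty_iso {X Y : FI} (h : Nat.card X.carrier = Nat.card Y.carrier) :
    Nonempty (X ≅ Y) := by
  obtain ⟨e⟩ := Finite.card_eq.1 h
  exact ⟨{ hom := e.toEmbedding
           inv := e.symm.toEmbedding
           hom_inv_id := Function.Embedding.ext e.symm_apply_apply
           inv_hom_id := Function.Embedding.ext e.apply_symm_apply }⟩

lemma nontrivial_obj_iff (V : FIMod R) {X Y : FI} (h : Nat.card X.carrier = Nat.card Y.carrier) :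
    Nontrivial (V.obj X) ↔ Nontrivial (V.obj Y) := by
  obtain ⟨e⟩ := FI.nonempty_iso h
  exact (V.mapIso e).toLinearEquiv.toEquiv.nontrivial_congr

lemma nontrivial_std_iff (V : FIMod R) (n : ℕ) :
    Nontrivial (V.obj (FI.std n)) ↔ Nontrivial (V.obj (FI.iter n)) :=
  V.nontrivial_obj_iff ((Nat.card_fin n).trans (FI.card_iter n).symm)

/-- The sub-`FI`-module `IV` for an ideal `I`. -/
def idealSub (V : FIMod R) (I : Ideal R) : V.Sub where
  obj X := I • ⊤
  map_le f := by
    rw [← Submodule.map_le_iff_le_comap, Submodule.map_smul'']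
    exact Submodule.smul_mono le_rfl le_top

open Classical in
/-- The sub-`FI`-module of elements in degrees at least `d`. -/
def truncSub (V : FIMod R) (d : ℕ) : V.Sub where
  obj X := if d ≤ Nat.card X.carrier then ⊤ else ⊥
  map_le {X Y} f := by
    by_cases h : d ≤ Nat.card X.carrier
    · have h' : d ≤ Nat.card Y.carrier :=
        h.trans (Nat.card_le_card_of_injective _ (Function.Embedding.injective f))
      rw [if_pos h']
      exact le_top
    · rw [if_neg h]
      exact bot_le

/-- The truncation is concentrated in the single degree `d`. -/
lemma truncSub_properMapsVanish (V : FIMod R) (d : ℕ)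
    (hV : ∀ X : FI, d < Nat.card X.carrier → Subsingleton (V.obj X)) :
    (V.truncSub d).toFIMod.ProperMapsVanish := by
  intro X Y f h
  refine ModuleCat.hom_ext (LinearMap.ext fun x => Subtype.ext ?_)
  by_cases hX : d ≤ Nat.card X.carrier
  · have := hV Y (hX.trans_lt h)
    exact Subsingleton.elim _ _
  · have hbot : (V.truncSub d).obj X = ⊥ := if_neg hX
    have hx0 : x.1 = 0 := (Submodule.mem_bot R).1 (hbot.le x.2)
    change (V.map f).hom x.1 = 0
    rw [hx0, map_zero]

/-- Passing to `V/IV` makes the lengths finite. In degree `d + a` the truncation contributes at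
least `C(d+a,d)` to homology, of order `a^d`, while the quotient below degree `d` can cancel only
order `a^(d-1)`. -/
lemma exists_nontrivial_tor (V : FIMod R) (hfin : ∀ X, Module.Finite R (V.obj X)) (d : ℕ)
    (hd : Nontrivial (V.obj (FI.iter d)))
    (hV : ∀ X : FI, d < Nat.card X.carrier → Subsingleton (V.obj X)) :
    ∃ a, 1 ≤ a ∧ Nontrivial ((tor R (FI.iter (d + a)) a).obj V) := by
  obtain ⟨I, hI, hne⟩ := Ideal.exists_isMaximal_smul_top_ne_top R (V.obj (FI.iter d))
  let N := V.idealSub I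
  have hV' : ∀ X : FI, d < Nat.card X.carrier → Subsingleton (N.quotient.obj X) := fun X hX =>
    have := hV X hX
    (Submodule.mkQ_surjective (N.obj X)).subsingleton
  let W := N.quotient.truncSub d
  have hL : Module.length R (W.quotient.obj (FI.iter (d - 1))) ≠ ⊤ := by
    have h₁ := Module.length_quotient_smul_top_ne_top R (V.obj (FI.iter (d - 1))) I hI
    have h₂ := Module.length_le_of_surjective _
      (Submodule.mkQ_surjective (W.obj (FI.iter (d - 1))))
    exact ne_top_of_le_ne_top h₁ h₂
  obtain ⟨L, hL⟩ := ENat.ne_top_iff_exists.1 hL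
  have hW : 1 ≤ Module.length R (W.toFIMod.obj (FI.iter d)) := by
    rw [Order.one_le_iff_ne_zero, Ne, Module.length_eq_zero_iff]
    intro h
    have hX : W.obj (FI.iter d) = ⊤ := if_pos (FI.card_iter d).ge
    refine hne ((Submodule.Quotient.subsingleton_iff (p := N.obj (FI.iter d))).1 ?_)
    refine ⟨fun x y => ?_⟩
    have := h.elim (⟨x, hX ▸ trivial⟩ : W.obj (FI.iter d)) ⟨y, hX ▸ trivial⟩
    exact congrArg Subtype.val this
  -- The homological degree `2 * k + 3` is odd, as `exists_epi_leftDerived_odd` requires, and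
  -- exceeds `d * L`, which contradicts the final count.
  let k := d * L
  refine ⟨2 * k + 3, by omega, ?_⟩
  by_contra hcon
  rw [not_nontrivial_iff_subsingleton] at hcon
  set n := d + (2 * k + 3) with hn
  -- Here `n - (2 * k + 2) = d + 1`, where `IV` vanishes; `IV` need not be finitely generated.
  have h₁ : IsZero ((tor R (FI.iter n) (2 * k + 2)).obj N.shortComplex.X₁) := by
    refine @ModuleCat.isZero_of_subsingleton _ _ _ ((Module.length_eq_zero_iff (R := R)).1 ?_)
    have hle := length_tor_le n (2 * k + 2) N.toFIMod
    have : Subsingleton (V.obj (FI.iter (n - (2 * k + 2)))) := hV _ (by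
      rw [FI.card_iter]; omega)
    have : Subsingleton (N.toFIMod.obj (FI.iter (n - (2 * k + 2)))) :=
      inferInstanceAs (Subsingleton (N.obj _))
    have hz : Module.length R (N.toFIMod.obj (FI.iter (n - (2 * k + 2)))) = 0 :=
      Module.length_eq_zero_iff.2 this
    rw [hz, mul_zero] at hle
    exact le_antisymm hle zero_le
  obtain ⟨e, he⟩ := exists_epi_leftDerived_odd (coinv R (FI.iter n)) k N.shortExact h₁
  have h₂ : IsZero ((tor R (FI.iter n) (2 * k + 3)).obj W.shortComplex.X₂) :=
    @ModuleCat.isZero_of_subsingleton _ _ _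
      (@Function.Surjective.subsingleton _ _ _ hcon ((ModuleCat.epi_iff_surjective e).1 he))
  obtain ⟨e', he'⟩ := exists_epi_leftDerived_even (coinv R (FI.iter n)) k W.shortExact h₂
  have h₃ := Module.length_le_of_surjective e'.hom ((ModuleCat.epi_iff_surjective e').1 he')
  have h₄ := h₃.trans (length_tor_le n (2 * k + 4) W.quotient)
  have h₅ := length_tor_eq n (2 * k + 3) W.toFIMod (N.quotient.truncSub_properMapsVanish d hV')
  have e₁ : n - (2 * k + 3) = d := by omega
  -- For `d = 0` this is `0`, which is harmless: `n.choose (2 * k + 4)` is then zero.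
  have e₂ : n - (2 * k + 4) = d - 1 := by omega
  rw [e₁] at h₅
  rw [e₂, ← hL] at h₄
  have h₆ : (n.choose (2 * k + 3) : ℕ∞) ≤ n.choose (2 * k + 4) * L :=
    calc (n.choose (2 * k + 3) : ℕ∞) = n.choose (2 * k + 3) * 1 := (mul_one _).symm
      _ ≤ n.choose (2 * k + 3) * _ := mul_le_mul_right hW _
      _ ≤ _ := h₅.symm.le.trans h₄
  have h₇ : n.choose (2 * k + 3) ≤ n.choose (2 * k + 4) * L := by exact_mod_cast h₆
  have h₈ : n.choose (2 * k + 4) * (2 * k + 4) = n.choose (2 * k + 3) * d := by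
    have := Nat.choose_succ_right_eq n (2 * k + 3)
    rwa [e₁] at this
  have hpos : 0 < n.choose (2 * k + 3) := Nat.choose_pos (by omega)
  -- Cancelling the binomial coefficient leaves `2 * k + 4 ≤ k`.
  have h₉ : n.choose (2 * k + 3) * (2 * k + 4) ≤ n.choose (2 * k + 3) * k :=
    calc n.choose (2 * k + 3) * (2 * k + 4) ≤ n.choose (2 * k + 4) * L * (2 * k + 4) :=
          Nat.mul_le_mul_right _ h₇
      _ = n.choose (2 * k + 4) * (2 * k + 4) * L := by ring
      _ = n.choose (2 * k + 3) * k := by rw [h₈, mul_assoc]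
  have := Nat.le_of_mul_le_mul_left h₉ hpos
  omega

lemma nontrivial_homology_iff (V : FIMod R) (n a : ℕ) :
    Nontrivial (((homology R a).obj V).obj (FI.std n)) ↔
      Nontrivial ((tor R (FI.iter n) a).obj V) := by
  obtain ⟨e⟩ := nonempty_homology_obj_iso V (FI.iter n) a
  exact (nontrivial_std_iff _ n).trans e.toLinearEquiv.toEquiv.nontrivial_congr

lemma nontrivial_of_nontrivial_homology (V : FIMod R) (n a : ℕ)
    (h : Nontrivial (((homology R a).obj V).obj (FI.std n))) :
    a ≤ n ∧ Nontrivial (V.obj (FI.std (n - a))) := by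
  rw [nontrivial_homology_iff, ← Module.length_pos_iff (R := R)] at h
  have h' := (h.trans_le (length_tor_le n a V)).ne'
  rw [mul_ne_zero_iff] at h'
  refine ⟨?_, ?_⟩
  · by_contra hlt
    exact h'.1 (by rw [Nat.choose_eq_zero_of_lt (not_le.1 hlt), Nat.cast_zero])
  · rw [nontrivial_std_iff, ← Module.length_pos_iff (R := R)]
    exact pos_iff_ne_zero.2 h'.2

/-- By the length bound, homology in degree `n` forces `V` to be nonzero in degree `n - a`. Any
integer `c` is allowed when `V` is zero. -/
lemma regularity_le (V : FIMod R) (c : ℤ)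
    (hc : ∀ n : ℕ, Nontrivial (V.obj (FI.std n)) → (n : ℤ) ≤ c) :
    V.regularity ≤ ((c : ℝ) : EReal) := by
  refine sInf_le ?_
  refine ⟨c, rfl, fun a _ => sSup_le ?_⟩
  rintro _ ⟨n, hn, rfl⟩
  obtain ⟨han, hn'⟩ := nontrivial_of_nontrivial_homology V n a hn
  have h₁ := hc _ hn'
  have h₂ : (n : ℤ) ≤ c + a := by omega
  have h₃ : (n : ℝ) ≤ ((c + a : ℤ) : ℝ) := by exact_mod_cast h₂
  exact EReal.coe_le_coe_iff.2 h₃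

lemma le_regularity (V : FIMod R) (hfin : ∀ X, Module.Finite R (V.obj X)) (d : ℕ)
    (hd : Nontrivial (V.obj (FI.std d)))
    (hV : ∀ n : ℕ, Nontrivial (V.obj (FI.std n)) → n ≤ d) :
    (d : EReal) ≤ V.regularity := by
  refine le_sInf ?_
  rintro _ ⟨c, rfl, hc⟩
  obtain ⟨a, ha, hnt⟩ := V.exists_nontrivial_tor hfin d ((nontrivial_std_iff V d).1 hd)
    fun X hX => by
      rw [← not_nontrivial_iff_subsingleton,
        V.nontrivial_obj_iff (Y := FI.std (Nat.card X.carrier)) (Nat.card_fin _).symm]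
      exact fun h => (hV _ h).not_gt hX
  have h₀ : ((d + a : ℕ) : EReal) ≤ ((homology R a).obj V).degree := by
    refine le_sSup ?_
    exact ⟨d + a, (nontrivial_homology_iff V (d + a) a).2 hnt, rfl⟩
  have h₁ : ((d + a : ℕ) : EReal) ≤ (((c + a : ℤ) : ℝ) : EReal) := h₀.trans (hc a ha)
  have h₂ : ((d + a : ℕ) : ℝ) ≤ ((c + a : ℤ) : ℝ) := EReal.coe_le_coe_iff.1 h₁
  have h₃ : ((d + a : ℕ) : ℤ) ≤ c + a := by exact_mod_cast h₂
  have h₄ : (d : ℤ) ≤ c := by push_cast at h₃; omega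
  have h₅ : (d : ℝ) ≤ (c : ℝ) := by exact_mod_cast h₄
  exact EReal.coe_le_coe_iff.2 h₅

end

end FIMod

theorem theorem1p2 {R : Type u} [CommRing R] (V : FIMod R)
    (hfg : V.FinitelyGenerated) (hdeg : V.degree < ⊤) :
    V.regularity = V.degree := by
  by_cases hne : ∃ n : ℕ, Nontrivial (V.obj (FI.std n))
  · obtain ⟨N, hN⟩ : ∃ N : ℕ, ∀ n : ℕ, Nontrivial (V.obj (FI.std n)) → n ≤ N := by
      obtain ⟨r, hr, -⟩ := EReal.lt_iff_exists_real_btwn.1 hdeg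
      obtain ⟨N, hN⟩ := exists_nat_ge r
      refine ⟨N, fun n hn => ?_⟩
      have h₀ : (n : EReal) ≤ V.degree := by
        refine le_sSup ?_
        exact ⟨n, hn, rfl⟩
      have h₁ : (n : EReal) < (r : EReal) := h₀.trans_lt hr
      have h₂ : (n : ℝ) < r := EReal.coe_lt_coe_iff.1 h₁
      exact_mod_cast h₂.le.trans hN
    have hbdd : BddAbove {n : ℕ | Nontrivial (V.obj (FI.std n))} := ⟨N, hN⟩
    have hd := Nat.sSup_mem (s := {n : ℕ | Nontrivial (V.obj (FI.std n))}) hne hbdd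
    set d := sSup {n : ℕ | Nontrivial (V.obj (FI.std n))}
    have hmax : ∀ n : ℕ, Nontrivial (V.obj (FI.std n)) → n ≤ d := fun n hn => le_csSup hbdd hn
    have hdegree : V.degree = (d : EReal) := by
      refine le_antisymm (sSup_le ?_) (le_sSup ?_)
      swap
      · exact ⟨d, hd, rfl⟩
      rintro _ ⟨n, hn, rfl⟩
      exact_mod_cast hmax n hn
    rw [hdegree]
    refine le_antisymm ?_ (V.le_regularity hfg.finite d hd hmax)
    exact (V.regularity_le d fun n hn => by exact_mod_cast hmax n hn).trans_eq (by norm_cast)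
  · have hbot : V.degree = ⊥ := by
      refine le_bot_iff.1 (sSup_le ?_)
      rintro _ ⟨n, hn, -⟩
      exact absurd ⟨n, hn⟩ hne
    -- For `V = 0` every integer bounds the regularity, so it is `-∞`.
    rw [hbot, EReal.eq_bot_iff_forall_lt]
    intro y
    obtain ⟨c, hc⟩ := exists_int_lt y
    exact (V.regularity_le c fun n hn => absurd ⟨n, hn⟩ hne).trans_lt
      (EReal.coe_lt_coe_iff.2 hc)
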